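/- **Markoff tree.** Define the left and right successors of a triple $(m,m_1,m_2)$ of integers as $(3mm_1-m_2,\,m_1,\,m)$ and $(3mm_2-m_1,\,m,\,m_2)$ respectively. The extended Markoff tree consists of the infinite binary tree with root $(5,1,2)$ generated by these successors, together with one further node $(2,1,1)$, whose only successor in the tree is its left successor $(5,1,2)$. Let $\Sigma^*$ be the set of its nodes (each triple occurs only once). A *zigzag* is an infinite sequence of nodes $\mathbf m^{(1)},\mathbf m^{(2)},\dots$ such that, for each $i\ge1$, $\mathbf m^{(i+1)}$ is the successor of $\mathbf m^{(i)}$ on some side and $\mathbf m^{(i+2)}$ is the successor of $\mathbf m^{(i+1)}$ on the other side; it is *maximal* if no node $\mathbf a$ makes $\mathbf a,\mathbf m^{(1)},\mathbf m^{(2)},\dots$ a zigzag. **Matrices.** Put $M=\begin{pmatrix}3&1\\-1&0\end{pmatrix}$. Consider the binary tree of triples of matrices with root $\left(\begin{pmatrix}5&3\\3&2\end{pmatrix},\begin{pmatrix}1&1\\1&2\end{pmatrix},\begin{pmatrix}2&1\\1&1\end{pmatrix}\right)$ in which $(\mathbf x,\mathbf x_1,\mathbf x_2)$ has left successor $(\mathbf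 x_1M\mathbf x,\mathbf x_1,\mathbf x)$ and right successor $(\mathbf xM\mathbf x_2,\mathbf x,\mathbf x_2)$. For $\mathbf m$ in the tree with root $(5,1,2)$, let $\mathbf x_{\mathbf m}$ be the first component of the triple of matrices at the same position as $\mathbf m$; moreover let $\mathbf x_{(2,1,1)}=\begin{pmatrix}2&1\\1&1\end{pmatrix}$. For $\mathbf m=(m,m_1,m_2)\in\Sigma^*$, with $k$ the off-diagonal (upper right) entry of $\mathbf x_{\mathbf m}$, put $$\alpha_{\mathbf m}=\frac{2k-3m+\sqrt{9m^2-4}}{2m},\qquad \bar\alpha_{\mathbf m}=\frac{2k-3m-\sqrt{9m^2-4}}{2m}.$$ **Extremal numbers.** Let $\gamma=(1+\sqrt5)/2$. A real number $\xi$ is *extremal* if it is neither rational nor quadratic over $\mathbb Q$ and if there is $c>0$ such that, for each real $X\ge1$, there is a non-zero $(x_0,x_1,x_2)\in\mathbb Z^3$ with $|x_0|\le X$, $|x_0\xi-x_1|\le cX^{-1/\gamma}$ and $|x_0\xi^2-x_2|\le cX^{-1/\gamma}$. A sequence $(\mathbf x_i)_{i\ge1}$ of symmetric $2\times2$ matrices,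 each with relatively prime integer coefficients, *corresponds* to $\xi$ if it is unbounded and $$\|\mathbf x_{i+1}\|\asymp\|\mathbf x_i\|^{\gamma},\qquad \|(\xi,-1)\mathbf x_i\|\asymp\|\mathbf x_i\|^{-1},\qquad |\det\mathbf x_i|\asymp1$$ with implied constants independent of $i$, where $\|\cdot\|$ is the largest absolute value of the coefficients. Let $\mathcal E_3^+$ be the set of extremal numbers with a corresponding sequence $(\mathbf x_i)_{i\ge1}$ of symmetric matrices in $\mathrm{SL}_2(\mathbb Z)$ such that, for each $i\ge1$, $\mathbf x_{i+2}=\mathbf x_{i+1}M_{i+1}\mathbf x_i$ where $M_i=\begin{pmatrix}3&(-1)^i\\(-1)^{i+1}&0\end{pmatrix}$. Two irrational real numbers $\eta,\xi$ are *equivalent* if $\eta=(a\xi+b)/(c\xi+d)$ for some $\begin{pmatrix}a&b\\c&d\end{pmatrix}\in\mathrm{GL}_2(\mathbb Z)$. **Theorem.** Each $\mathbf m\in\Sigma^*$ is the first element of a unique maximal zigzag $\mathbf m=\mathbf m^{(1)},\mathbf m^{(2)},\mathbf m^{(3)},\dots$. The sequence $(\mathbf x_{\mathbf m^{(i)}})_{i\ge1}$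 consists of symmetric matrices in $\mathrm{SL}_2(\mathbb Z)$ and corresponds to an extremal number $\xi_{\mathbf m}\in\mathcal E_3^+\cap(1/2,1)$, and $$\xi_{\mathbf m}=\lim_{i\to\infty}\alpha_{\mathbf m^{(i)}}=\lim_{i\to\infty}\bigl(\bar\alpha_{\mathbf m^{(i)}}+3\bigr).$$ Moreover, each element of $\mathcal E_3^+$ is equivalent to $\xi_{\mathbf m}$ for one and only one $\mathbf m\in\Sigma^*$. -/

import Mathlib

open Filter Topology

namespace MarkoffExtremal

/-- Ordered triples `(m, m₁, m₂)` of integers. -/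
abbrev Triple := ℤ × ℤ × ℤ

/-- Integral `2 × 2` matrices. -/
abbrev Mat := Matrix (Fin 2) (Fin 2) ℤ

/-- The two sides on which a node of a binary tree has a successor. -/
inductive Side where
  | left
  | right

/-- The side opposite to a given one. -/
def Side.other : Side → Side
  | .left => .right
  | .right => .left

/-- The successor of a triple on a given side: `(3mm₁ - m₂, m₁, m)` on the left and
`(3mm₂ - m₁, m, m₂)` on the right. -/
def Triple.step : Side → Triple → Triple
  | .left, (m, m₁, m₂) => (3 * m * m₁ - m₂, m₁, m)
  | .right, (m, m₁, m₂) => (3 * m * m₂ - m₁, m, m₂)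

/-- The matrix `M`. -/
def matM : Mat := !![3, 1; -1, 0]

/-- The successor of a triple of matrices on a given side: `(x₁Mx, x₁, x)` on the left and
`(xMx₂, x, x₂)` on the right. -/
def matStep : Side → Mat × Mat × Mat → Mat × Mat × Mat
  | .left, (x, x₁, _) => (x₁ * matM * x, x₁, x)
  | .right, (x, _, x₂) => (x * matM * x₂, x, x₂)

/-- The node of the Markoff tree with root `(5,1,2)` at a given position. The position is the list
of the sides taken on the way from the root, the last one taken being the head of the list. -/
def tripleAt : List Side → Triple
  | [] => (5, 1, 2)
  | s :: p => Triple.step s (tripleAt p)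

/-- The node of the tree of triples of matrices at a given position. -/
def matAt : List Side → Mat × Mat × Mat
  | [] => (!![5, 3; 3, 2], !![1, 1; 1, 2], !![2, 1; 1, 1])
  | s :: p => matStep s (matAt p)

/-- The set `Σ*` of the nodes of the extended Markoff tree: the node `(2,1,1)`, whose only successor
is its left successor `(5,1,2)`, and the nodes of the Markoff tree with root `(5,1,2)`. -/
def SigmaStar : Set Triple := insert (2, 1, 1) (Set.range tripleAt)

lemma tripleAt_spec (p : List Side) :
    0 < (tripleAt p).2.1 ∧ 0 < (tripleAt p).2.2 ∧
      (tripleAt p).2.1 < (tripleAt p).1 ∧ (tripleAt p).2.2 < (tripleAt p).1 ∧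
      (tripleAt p).2.1 ≠ (tripleAt p).2.2 := by
  induction p with
  | nil => simp [tripleAt]
  | cons s p ih =>
    obtain ⟨h1, h2, h3, h4, h5⟩ := ih
    simp only [tripleAt]
    generalize tripleAt p = t at *
    obtain ⟨a, b, c⟩ := t
    cases s <;> simp only [Triple.step] at * <;> refine ⟨?_, ?_, ?_, ?_, ?_⟩ <;>
      first | omega | nlinarith

/-- Distinct positions of the Markoff tree carry distinct triples. -/
lemma tripleAt_injective : Function.Injective tripleAt := by
  intro p
  induction p with
  | nil =>
    intro q h
    cases q with
    | nil => rfl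
    | cons s q =>
      exfalso
      have hq := tripleAt_spec q
      simp only [tripleAt] at h
      generalize tripleAt q = t at *
      obtain ⟨a, b, c⟩ := t
      cases s <;> simp only [Triple.step, Prod.mk.injEq] at *
      · obtain ⟨h1, h2, h3⟩ := h
        subst h2 h3
        omega
      · omega
  | cons s p ih =>
    intro q h
    have hp := tripleAt_spec p
    cases q with
    | nil =>
      exfalso
      simp only [tripleAt] at h
      generalize tripleAt p = t at *
      obtain ⟨a, b, c⟩ := t
      cases s <;> simp only [Triple.step, Prod.mk.injEq] at *
      · obtain ⟨h1, h2, h3⟩ := h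
        subst h2 h3
        omega
      · omega
    | cons s' q =>
      have hq := tripleAt_spec q
      simp only [tripleAt] at h
      have key : s = s' ∧ tripleAt p = tripleAt q := by
        generalize tripleAt p = t at *
        generalize tripleAt q = t' at *
        obtain ⟨a, b, c⟩ := t
        obtain ⟨a', b', c'⟩ := t'
        cases s <;> cases s' <;> simp only [Triple.step, Prod.mk.injEq] at *
        · obtain ⟨h1, rfl, rfl⟩ := h
          exact ⟨trivial, rfl, rfl, by linarith⟩
        · omega
        · omega
        · obtain ⟨h1, rfl, rfl⟩ := h
          exact ⟨trivial, rfl, by linarith, rfl⟩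
      rw [key.1, ih key.2]

lemma root_notMem_range : ((2, 1, 1) : Triple) ∉ Set.range tripleAt := by
  rintro ⟨p, h⟩
  cases p with
  | nil => simp [tripleAt] at h
  | cons s p =>
    have hp := tripleAt_spec p
    simp only [tripleAt] at h
    generalize tripleAt p = t at *
    obtain ⟨a, b, c⟩ := t
    cases s <;> simp only [Triple.step, Prod.mk.injEq] at * <;> omega

open Classical in
/-- The symmetric matrix `x_m` attached to a solution `m` of Markoff's equation: the first component
of the triple of matrices which is at the position of `m`, for `m` in the tree with root `(5,1,2)`,
completed by the values at `(2,1,1)` and at `(1,1,1)` (the last value is also used as a default for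
the triples that are not solutions). -/
noncomputable def xMat (m : Triple) : Mat :=
  if m = (2, 1, 1) then !![2, 1; 1, 1]
  else if h : ∃ p, tripleAt p = m then (matAt h.choose).1
  else !![1, 1; 1, 2]

lemma xMat_root : xMat (2, 1, 1) = !![2, 1; 1, 1] := if_pos rfl

lemma xMat_tripleAt (p : List Side) : xMat (tripleAt p) = (matAt p).1 := by
  have h1 : tripleAt p ≠ (2, 1, 1) := fun h => root_notMem_range ⟨p, h⟩
  have h2 : ∃ q, tripleAt q = tripleAt p := ⟨p, rfl⟩
  rw [xMat, if_neg h1, dif_pos h2, tripleAt_injective h2.choose_spec]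

/-- The quadratic number `α_m`, where `k` is the off-diagonal entry of `x_m`. -/
noncomputable def alpha (m : Triple) : ℝ :=
  (2 * (xMat m 0 1 : ℝ) - 3 * (m.1 : ℝ) + √(9 * (m.1 : ℝ) ^ 2 - 4)) / (2 * (m.1 : ℝ))

/-- The conjugate of `α_m`. -/
noncomputable def alphaBar (m : Triple) : ℝ :=
  (2 * (xMat m 0 1 : ℝ) - 3 * (m.1 : ℝ) - √(9 * (m.1 : ℝ) ^ 2 - 4)) / (2 * (m.1 : ℝ))

/-- `n` is the successor of `m` on the side `s` in the extended Markoff tree. -/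
def IsSuccessor (s : Side) (m n : Triple) : Prop :=
  m ∈ SigmaStar ∧ n ∈ SigmaStar ∧ n = Triple.step s m

/-- A zigzag of the extended Markoff tree: each node is followed by its successor on some side, and
the latter by its own successor on the other side. The first node has index `0`. -/
def IsZigzag (z : ℕ → Triple) : Prop :=
  ∀ i, ∃ s : Side, IsSuccessor s (z i) (z (i + 1)) ∧ IsSuccessor s.other (z (i + 1)) (z (i + 2))

/-- The sequence `a, z 0, z 1, …`. -/
def prepend (a : Triple) (z : ℕ → Triple) : ℕ → Triple
  | 0 => a
  | i + 1 => z i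

/-- A zigzag is maximal if no node can be inserted before its first node so as to
form a longer zigzag. -/
def IsMaximalZigzag (z : ℕ → Triple) : Prop :=
  IsZigzag z ∧ ∀ a, ¬ IsZigzag (prepend a z)

/-- Extremal numbers: the real numbers `ξ`, neither rational nor quadratic over `ℚ`, for which
there is a constant `c > 0` such that, for each real `X ≥ 1`, the system `|x₀| ≤ X`,
`|x₀ξ - x₁| ≤ cX^{-1/γ}`, `|x₀ξ² - x₂| ≤ cX^{-1/γ}` has a non-zero solution in integers. -/
def IsExtremal (ξ : ℝ) : Prop :=
  (∀ a b c : ℤ, a * ξ ^ 2 + b * ξ + c = 0 → a = 0 ∧ b = 0 ∧ c = 0) ∧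
  ∃ c : ℝ, 0 < c ∧ ∀ X : ℝ, 1 ≤ X → ∃ x₀ x₁ x₂ : ℤ, (x₀, x₁, x₂) ≠ (0, 0, 0) ∧
    |(x₀ : ℝ)| ≤ X ∧
    |x₀ * ξ - x₁| ≤ c * X ^ (-(1 / Real.goldenRatio)) ∧
    |x₀ * ξ ^ 2 - x₂| ≤ c * X ^ (-(1 / Real.goldenRatio))

/-- The largest absolute value of the coefficients of a matrix. -/
def matNorm (x : Mat) : ℝ :=
  max (max |(x 0 0 : ℝ)| |(x 0 1 : ℝ)|) (max |(x 1 0 : ℝ)| |(x 1 1 : ℝ)|)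

/-- The largest absolute value of the coordinates of the row `(ξ, -1) x`. -/
def rowNorm (ξ : ℝ) (x : Mat) : ℝ :=
  max |ξ * x 0 0 - x 1 0| |ξ * x 0 1 - x 1 1|

/-- `f i ≍ g i`, with implied constants independent of `i`. -/
def Asymp (f g : ℕ → ℝ) : Prop :=
  ∃ c C : ℝ, 0 < c ∧ 0 < C ∧ ∀ i, c * g i ≤ f i ∧ f i ≤ C * g i

/-- The coefficients of `x` are relatively prime as a whole. -/
def IsPrimitive (x : Mat) : Prop :=
  ∀ d : ℤ, (∀ i j, d ∣ x i j) → IsUnit d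

/-- `x` is a sequence of matrices corresponding to the real number `ξ`: an unbounded sequence of
symmetric primitive integral matrices with `‖x_{i+1}‖ ≍ ‖x_i‖^γ`, `‖(ξ,-1)x_i‖ ≍ ‖x_i‖⁻¹` and
`|det x_i| ≍ 1`. -/
def IsMatrixSequence (ξ : ℝ) (x : ℕ → Mat) : Prop :=
  (∀ i, (x i).IsSymm) ∧ (∀ i, IsPrimitive (x i)) ∧
  (∀ B : ℝ, ∃ i, B < matNorm (x i)) ∧
  Asymp (fun i => matNorm (x (i + 1))) (fun i => matNorm (x i) ^ Real.goldenRatio) ∧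
  Asymp (fun i => rowNorm ξ (x i)) (fun i => (matNorm (x i))⁻¹) ∧
  Asymp (fun i => |((x i).det : ℝ)|) (fun _ => 1)

/-- The matrix `M_i` with rows `(u, (-1)^i)` and `((-1)^(i+1), 0)`. -/
def matE (u : ℤ) (i : ℕ) : Mat := !![u, (-1) ^ i; (-1) ^ (i + 1), 0]

/-- The set `E_u⁺` of the extremal numbers with a corresponding sequence of symmetric matrices
`x_1, x_2, …` in `SL₂(ℤ)` such that `x_{i+2} = x_{i+1} M_{i+1} x_i` for each `i ≥ 1`. Here `x j`
stands for `x_{j+1}`. -/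
def EPlus (u : ℤ) : Set ℝ :=
  {ξ | IsExtremal ξ ∧ ∃ x : ℕ → Mat, IsMatrixSequence ξ x ∧ (∀ j, (x j).det = 1) ∧
    ∀ j, x (j + 2) = x (j + 1) * matE u (j + 2) * x j}

/-- Equivalence under the action of `GL₂(ℤ)` by linear fractional transformations (used for
irrational numbers only, so that the denominator does not vanish). -/
def Equivalent (η ξ : ℝ) : Prop :=
  ∃ g : GL (Fin 2) ℤ, η = (g.1 0 0 * ξ + g.1 0 1) / (g.1 1 0 * ξ + g.1 1 1)

end MarkoffExtremal

/-!
# Extremal numbers attached to the nodes of the Markoff tree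

Write `m`, `k`, `l` for the coefficients of a symmetric matrix of determinant `1`. The argument rests
on sequences of such matrices with `x_{i+2} = x_{i+1} N_i x_i`, where `N_i` is alternately
`M` and its transpose (`IsChain`). The symmetry of `x_{i+2}` makes the upper left coefficients
satisfy Markoff's equation (`IsChain.markoff`) and the recurrence `m_{i+3} = 3 m_{i+2} m_{i+1} - m_i`
(`IsChain.fst_recurrence`), which is the rule for the successors in a zigzag of the Markoff tree; it
also gives `k_{i+1} / m_{i+1} - k_{i+2} / m_{i+2} = ± m_i / (m_{i+1} m_{i+2})` (`IsChain.cross`).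

Along a zigzag, the matrices `x_m` form such a chain (`IsZigzag.isReduced`), with `m_i` growing like a
sequence such that `m_{i+1} ≍ m_i ^ γ` (`IsGrowing.growth`). So the quotients `k_i / m_i` converge to
some `ξ` with an error at most `2 / m_i²`, and this provides the approximations to `ξ` and `ξ²` required
from an extremal number. The number `ξ` is neither rational nor quadratic because three consecutive
matrices of a chain are linearly independent (`det₃_eq`, `IsReduced.not_quadratic`).

Conversely, a sequence of matrices corresponding to an element of `E₃⁺` becomes, after a change of
signs, a chain with positive upper left coefficients. Descent for Markoff's equation
(`mem_tree_of_markoff'`) shows that these coefficients eventually follow a zigzag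
(`exists_zigzag_of_mem_EPlus`), which is a tail of a maximal one. As the upper left coefficients
determine the quotients `k_i / m_i` up to sign and translation by an integer
(`limit_eq_of_fst_eq`), the given number is equivalent to the one attached to the first node of this
maximal zigzag.

Finally, all but finitely many of the very good approximations to the limit of a chain belong to the
chain (`IsReduced.exists_eq`), by the vanishing of two determinants of size three. Hence, if the
limits of two chains are equivalent, the matrix of the equivalence carries one chain to the
other up to a shift and finitely many elements. It is then compatible with the matrices `N_i`, so it
fixes the first basis vector up to sign and preserves the upper left coefficients (`exists_shift`). The
two zigzags have a common tail (`zigzag_eq_of_fst`), and being maximal they have the same first node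
(`maximal_eq_of_tail`).
-/

namespace MarkoffExtremal

/-! ### Nodes of the extended tree and their successors -/

lemma range_subset_sigmaStar (p : List Side) : tripleAt p ∈ SigmaStar := Or.inr ⟨p, rfl⟩

lemma spec_of_mem {t : Triple} (h : t ∈ SigmaStar) :
    0 < t.2.1 ∧ 0 < t.2.2 ∧ t.2.1 < t.1 ∧ t.2.2 < t.1 := by
  rcases h with rfl | ⟨p, rfl⟩
  · norm_num
  · have := tripleAt_spec p
    exact ⟨this.1, this.2.1, this.2.2.1, this.2.2.2.1⟩

/-- The order of the last two components of a successor tells on which side it is. -/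
lemma step_left_lt {t : Triple} (h : t ∈ SigmaStar) :
    (Triple.step .left t).2.1 < (Triple.step .left t).2.2 :=
  (spec_of_mem h).2.2.1

lemma step_right_lt {t : Triple} (h : t ∈ SigmaStar) :
    (Triple.step .right t).2.2 < (Triple.step .right t).2.1 :=
  (spec_of_mem h).2.2.2

lemma step_inj {s s' : Side} {a b : Triple} (ha : a ∈ SigmaStar) (hb : b ∈ SigmaStar)
    (h : Triple.step s a = Triple.step s' b) : s = s' ∧ a = b := by
  have hs : s = s' := by
    cases s <;> cases s'
    · rfl
    · have h1 := step_left_lt ha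
      have h2 := step_right_lt hb
      rw [h] at h1; omega
    · have h1 := step_right_lt ha
      have h2 := step_left_lt hb
      rw [h] at h1; omega
    · rfl
  subst hs
  refine ⟨rfl, ?_⟩
  obtain ⟨m, m₁, m₂⟩ := a
  obtain ⟨n, n₁, n₂⟩ := b
  cases s <;> simp only [Triple.step, Prod.mk.injEq] at h ⊢
  · obtain ⟨h1, rfl, rfl⟩ := h
    exact ⟨rfl, rfl, by linarith⟩
  · obtain ⟨h1, rfl, rfl⟩ := h
    exact ⟨rfl, by linarith, rfl⟩

lemma lt_step_fst {t : Triple} (h : t ∈ SigmaStar) (s : Side) : t.1 < (Triple.step s t).1 := by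
  have := spec_of_mem h
  obtain ⟨m, m₁, m₂⟩ := t
  cases s <;> simp only [Triple.step] at * <;> nlinarith

lemma other_other (s : Side) : s.other.other = s := by cases s <;> rfl

/-- The only node that is not a successor is `(2,1,1)`, whose components are too small. -/
lemma step_ne_root {t : Triple} (h : t ∈ SigmaStar) (s : Side) :
    Triple.step s t ≠ (2, 1, 1) := by
  intro h'
  cases s
  · have := step_left_lt h
    rw [h'] at this; norm_num at this
  · have := step_right_lt h
    rw [h'] at this; norm_num at this

/-- The side on which the maximal zigzag starting at a node leaves this node. It is the side from
which the tree enters the node, and the left one at `(2,1,1)`. -/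
def firstSide (t : Triple) : Side := if t.2.1 ≤ t.2.2 then .left else .right

lemma exists_parent {t : Triple} (h : t ∈ SigmaStar) (h0 : t ≠ (2, 1, 1)) :
    ∃ a ∈ SigmaStar, t = Triple.step (firstSide t) a := by
  rcases h with h | ⟨p, rfl⟩
  · exact absurd h h0
  cases p with
  | nil => exact ⟨(2, 1, 1), Or.inl rfl, by simp [tripleAt, firstSide, Triple.step]⟩
  | cons s p =>
    have hp := range_subset_sigmaStar p
    refine ⟨_, hp, ?_⟩
    have hs : firstSide (tripleAt (s :: p)) = s := by
      simp only [tripleAt]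
      cases s
      · exact if_pos (step_left_lt hp).le
      · exact if_neg (not_le.mpr (step_right_lt hp))
    rw [hs]; rfl

lemma step_mem_range (s : Side) {t : Triple} (h : t ∈ Set.range tripleAt) :
    Triple.step s t ∈ Set.range tripleAt := by
  obtain ⟨p, rfl⟩ := h
  exact ⟨s :: p, rfl⟩

lemma mem_range_of_ne_root {t : Triple} (h : t ∈ SigmaStar) (h0 : t ≠ (2, 1, 1)) :
    t ∈ Set.range tripleAt := h.resolve_left h0

/-- Exchanging the last two components of a node of the tree does not yield a node of the tree. -/
lemma swap_ne (p q : List Side) :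
    tripleAt p ≠ ((tripleAt q).1, (tripleAt q).2.2, (tripleAt q).2.1) := by
  induction p generalizing q with
  | nil =>
    intro h
    cases q with
    | nil => simp [tripleAt] at h
    | cons s q =>
      have hq := tripleAt_spec q
      simp only [tripleAt] at h
      generalize tripleAt q = t at *
      obtain ⟨a, b, c⟩ := t
      cases s <;> simp only [Triple.step, Prod.mk.injEq] at * <;> omega
  | cons s p ih =>
    intro h
    have hp := tripleAt_spec p
    cases q with
    | nil =>
      simp only [tripleAt] at h
      generalize tripleAt p = t at *
      obtain ⟨a, b, c⟩ := t
      cases s <;> simp only [Triple.step, Prod.mk.injEq] at * <;> omega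
    | cons s' q =>
      have hq := tripleAt_spec q
      have ih := ih q
      simp only [tripleAt] at h
      generalize tripleAt p = t at *
      generalize tripleAt q = t' at *
      obtain ⟨a, b, c⟩ := t
      obtain ⟨a', b', c'⟩ := t'
      cases s <;> cases s' <;> simp only [Triple.step, Prod.mk.injEq] at *
      · omega
      · obtain ⟨h1, rfl, rfl⟩ := h
        exact ih (by rw [Prod.mk.injEq, Prod.mk.injEq]; exact ⟨rfl, rfl, by linarith⟩)
      · obtain ⟨h1, rfl, rfl⟩ := h
        exact ih (by rw [Prod.mk.injEq, Prod.mk.injEq]; exact ⟨rfl, by linarith, rfl⟩)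
      · omega

lemma tripleAt_coprime (p : List Side) :
    IsCoprime (tripleAt p).1 (tripleAt p).2.1 ∧ IsCoprime (tripleAt p).1 (tripleAt p).2.2 ∧
      IsCoprime (tripleAt p).2.1 (tripleAt p).2.2 := by
  induction p with
  | nil =>
    simp only [tripleAt]
    exact ⟨isCoprime_one_right, ⟨1, -2, by norm_num⟩, isCoprime_one_left⟩
  | cons s p ih =>
    obtain ⟨⟨u, v, h1⟩, ⟨u', v', h2⟩, ⟨u'', v'', h3⟩⟩ := ih
    simp only [tripleAt]
    generalize tripleAt p = t at *
    obtain ⟨a, b, c⟩ := t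
    cases s <;> simp only [Triple.step] at *
    · exact ⟨⟨-v'', u'' + 3 * a * v'', by linear_combination h3⟩,
        ⟨-v', u' + 3 * b * v', by linear_combination h2⟩, ⟨v, u, by linear_combination h1⟩⟩
    · exact ⟨⟨-v, u + 3 * c * v, by linear_combination h1⟩,
        ⟨-u'', v'' + 3 * a * u'', by linear_combination h3⟩, ⟨u', v', by linear_combination h2⟩⟩

/-- Descent for Markoff's equation: up to the order of its two smaller components, a positive
solution is a node of the tree, unless its two smaller components are equal. -/
lemma mem_tree_of_markoff (n : ℕ) : ∀ a b c : ℤ, a ≤ n → 0 < b → b < c → c < a →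
    a ^ 2 + b ^ 2 + c ^ 2 = 3 * a * b * c →
    (a, b, c) ∈ Set.range tripleAt ∨ (a, c, b) ∈ Set.range tripleAt := by
  induction n with
  | zero => intro a b c h1 h2 h3 h4; push_cast at h1; omega
  | succ n ih =>
    intro a b c han hb hbc hca he
    set d := 3 * b * c - a with hd
    have had : a * d = b ^ 2 + c ^ 2 := by rw [hd]; linear_combination -he
    have hd0 : 0 < d := by
      by_contra hneg
      have : a * d ≤ 0 := mul_nonpos_of_nonneg_of_nonpos (by omega) (by omega)
      nlinarith
    -- `c` lies between the two roots `d` and `a` of the quadratic polynomial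
    -- `X ^ 2 - 3 b c X + b ^ 2 + c ^ 2`.
    have hdc : d < c := by
      by_contra hneg
      have h1 : 0 ≤ (a - c) * (d - c) := mul_nonneg (by omega) (by omega)
      have h2 : (a - c) * (d - c) = 2 * c ^ 2 + b ^ 2 - 3 * b * c ^ 2 := by
        rw [hd] at had ⊢; linear_combination had
      nlinarith [mul_pos hb (sq_pos_of_pos (hb.trans hbc)), sq_nonneg c]
    have he' : c ^ 2 + b ^ 2 + d ^ 2 = 3 * c * b * d := by rw [hd]; linear_combination he
    have hab : a = 3 * c * b - d := by rw [hd]; ring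
    rcases lt_trichotomy b d with h | h | h
    · rcases ih c b d (by push_cast at han; omega) hb h hdc he' with h' | h'
      · left
        simpa [Triple.step, ← hab] using step_mem_range .left h'
      · right
        simpa [Triple.step, ← hab] using step_mem_range .right h'
    · rw [← h] at he' hab
      have hcb : c ^ 2 = b ^ 2 * (3 * c - 2) := by linear_combination he'
      have hdvd : b ∣ c := (Int.pow_dvd_pow_iff two_ne_zero).mp ⟨_, hcb⟩
      obtain ⟨t, rfl⟩ := hdvd
      have ht : t * (3 * b - t) = 2 := by
        have : b ^ 2 * (t * (3 * b - t)) = b ^ 2 * 2 := by linear_combination -hcb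
        exact mul_left_cancel₀ (pow_ne_zero 2 hb.ne') this
      have ht1 : 1 < t := by nlinarith
      have ht2 : t ≤ 2 := Int.le_of_dvd (by norm_num) ⟨_, ht.symm⟩
      obtain rfl : t = 2 := by omega
      obtain rfl : b = 1 := by omega
      left
      exact ⟨[], by simp [tripleAt, hab]⟩
    · rcases ih c d b (by push_cast at han; omega) hd0 h (by omega)
        (by linear_combination he') with h' | h'
      · right
        simpa [Triple.step, ← hab] using step_mem_range .right h'
      · left
        simpa [Triple.step, ← hab] using step_mem_range .left h'

lemma mem_tree_of_markoff' {a b c : ℤ} (ha : 2 < a) (hb : 0 < b) (hc : 0 < c) (hba : b < a)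
    (hca : c < a) (he : a ^ 2 + b ^ 2 + c ^ 2 = 3 * a * b * c) :
    (a, b, c) ∈ Set.range tripleAt ∨ (a, c, b) ∈ Set.range tripleAt := by
  rcases lt_trichotomy b c with h | h | h
  · exact mem_tree_of_markoff a.toNat a b c (by omega) hb h hca he
  · exfalso
    subst h
    have h1 : a ^ 2 = b ^ 2 * (3 * a - 2) := by linear_combination he
    obtain ⟨t, rfl⟩ := (Int.pow_dvd_pow_iff two_ne_zero).mp ⟨_, h1⟩
    have ht : t * (3 * b - t) = 2 := by
      have : b ^ 2 * (t * (3 * b - t)) = b ^ 2 * 2 := by linear_combination -h1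
      exact mul_left_cancel₀ (pow_ne_zero 2 hb.ne') this
    have ht1 : 1 < t := by nlinarith
    have ht2 : t ≤ 2 := Int.le_of_dvd (by norm_num) ⟨_, ht.symm⟩
    obtain rfl : t = 2 := by omega
    omega
  · exact (mem_tree_of_markoff a.toNat a c b (by omega) hc h hba
      (by linear_combination he)).symm

/-! ### Zigzags -/

/-- The sequence of sides `s, s.other, s, s.other, …`. -/
def altSide (s : Side) : ℕ → Side
  | 0 => s
  | i + 1 => (altSide s i).other

lemma altSide_other (s : Side) (i : ℕ) : altSide s.other i = (altSide s i).other := by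
  induction i with
  | zero => rfl
  | succ i ih => simp only [altSide, ih]

lemma side_unique {s s' : Side} {a b : Triple} (h : IsSuccessor s a b) (h' : IsSuccessor s' a b) :
    s = s' :=
  (step_inj h.1 h.1 (h.2.2.symm.trans h'.2.2)).1

lemma isZigzag_iff {z : ℕ → Triple} :
    IsZigzag z ↔ ∃ s, ∀ i, IsSuccessor (altSide s i) (z i) (z (i + 1)) := by
  constructor
  · intro h
    obtain ⟨s, hs, -⟩ := h 0
    refine ⟨s, fun i => ?_⟩
    induction i with
    | zero => exact hs
    | succ i ih =>
      obtain ⟨s', h1, h2⟩ := h i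
      rw [side_unique h1 ih] at h2
      exact h2
  · rintro ⟨s, h⟩ i
    exact ⟨altSide s i, h i, h (i + 1)⟩

/-- The sequence of triples that starts at `t` and leaves it on the side `s`, with alternate
sides. -/
def zig (s : Side) (t : Triple) : ℕ → Triple
  | 0 => t
  | i + 1 => Triple.step (altSide s i) (zig s t i)

lemma eq_zig {z : ℕ → Triple} {s : Side}
    (h : ∀ i, IsSuccessor (altSide s i) (z i) (z (i + 1))) : z = zig s (z 0) := by
  funext i
  induction i with
  | zero => rfl
  | succ i ih => rw [(h i).2.2, zig, ← ih]

lemma zig_succ {s : Side} {t : Triple} (ht : t ∈ SigmaStar)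
    (h1 : Triple.step s t ∈ Set.range tripleAt) (i : ℕ) :
    IsSuccessor (altSide s i) (zig s t i) (zig s t (i + 1)) := by
  have hr : ∀ i, zig s t (i + 1) ∈ Set.range tripleAt := by
    intro i
    induction i with
    | zero => exact h1
    | succ i ih => exact step_mem_range _ ih
  refine ⟨?_, Or.inr (hr i), rfl⟩
  cases i with
  | zero => exact ht
  | succ i => exact Or.inr (hr i)

lemma step_firstSide_mem {t : Triple} (ht : t ∈ SigmaStar) :
    Triple.step (firstSide t) t ∈ Set.range tripleAt := by
  rcases ht with rfl | h
  · exact ⟨[], by simp [firstSide, tripleAt, Triple.step]⟩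
  · exact step_mem_range _ h

lemma IsZigzag.mem {z : ℕ → Triple} (h : IsZigzag z) (i : ℕ) : z i ∈ SigmaStar := by
  obtain ⟨s, hs⟩ := isZigzag_iff.mp h
  exact (hs i).1

lemma prepend_isZigzag {a : Triple} {z : ℕ → Triple} {s : Side}
    (h : ∀ i, IsSuccessor (altSide s i) (z i) (z (i + 1))) (ha : IsSuccessor s.other a (z 0)) :
    IsZigzag (prepend a z) := by
  refine isZigzag_iff.mpr ⟨s.other, fun i => ?_⟩
  cases i with
  | zero => exact ha
  | succ i =>
    have := h i
    simp only [altSide, altSide_other, other_other]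
    exact this

/-- The right successor of `(2,1,1)`, namely `(5,2,1)`, is not in the tree as it is obtained from
`(5,1,2)` by an exchange. -/
lemma root_side {s : Side} {n : Triple} (h : IsSuccessor s (2, 1, 1) n) : s = .left := by
  cases s with
  | left => rfl
  | right =>
    exfalso
    obtain ⟨h0, h1, h2⟩ := h
    rw [h2] at h1
    obtain ⟨p, hp⟩ := mem_range_of_ne_root h1 (step_ne_root h0 _)
    exact swap_ne p [] (by simpa [tripleAt, Triple.step] using hp)

/-- A zigzag is maximal exactly when it leaves its first node on the side from which the tree enters
this node. -/
lemma isMaximalZigzag_iff {z : ℕ → Triple} :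
    IsMaximalZigzag z ↔
      ∀ i, IsSuccessor (altSide (firstSide (z 0)) i) (z i) (z (i + 1)) := by
  constructor
  · rintro ⟨hz, hmax⟩
    obtain ⟨s, hs⟩ := isZigzag_iff.mp hz
    have h0 := (hs 0).1
    by_cases hroot : z 0 = (2, 1, 1)
    · have hf : firstSide (z 0) = .left := by rw [hroot]; rfl
      have h1 := hs 0
      rw [hroot] at h1
      have hl : s = .left := root_side h1
      rwa [hf, ← hl]
    · obtain ⟨a, ha, hza⟩ := exists_parent h0 hroot
      by_cases hsf : s = firstSide (z 0)
      · rwa [← hsf]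
      · have hso : s.other = firstSide (z 0) := by
          generalize firstSide (z 0) = s' at hsf ⊢
          cases s <;> cases s' <;> first | rfl | exact absurd rfl hsf
        exact absurd (prepend_isZigzag hs ⟨ha, h0, by rw [hso]; exact hza⟩) (hmax a)
  · intro h
    refine ⟨isZigzag_iff.mpr ⟨_, h⟩, fun a ha => ?_⟩
    obtain ⟨s, h1, h2⟩ := ha 0
    have h3 : s.other = firstSide (z 0) := side_unique h2 (h 0)
    have h4 : z 0 = Triple.step s a := h1.2.2
    have ha' : a ∈ SigmaStar := h1.1
    cases s
    · have := step_left_lt ha'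
      rw [← h4] at this
      rw [firstSide, if_pos this.le] at h3
      cases h3
    · have := step_right_lt ha'
      rw [← h4] at this
      rw [firstSide, if_neg (not_le.mpr this)] at h3
      cases h3

lemma existsUnique_maximalZigzag (m : Triple) (hm : m ∈ SigmaStar) :
    ∃! z : ℕ → Triple, IsMaximalZigzag z ∧ z 0 = m := by
  refine ⟨zig (firstSide m) m, ⟨isMaximalZigzag_iff.mpr (zig_succ hm (step_firstSide_mem hm)), rfl⟩,
    ?_⟩
  rintro z ⟨hz, rfl⟩
  exact eq_zig (isMaximalZigzag_iff.mp hz)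

/-- Each zigzag is a tail of a maximal one. -/
lemma IsZigzag.exists_maximal (n : ℕ) : ∀ z : ℕ → Triple, IsZigzag z → (z 0).1 ≤ n →
    ∃ (w : ℕ → Triple) (N : ℕ), IsMaximalZigzag w ∧ ∀ i, w (i + N) = z i := by
  induction n with
  | zero =>
    intro z hz h
    have := spec_of_mem (hz.mem 0)
    push_cast at h; omega
  | succ n ih =>
    intro z hz h
    by_cases hmax : ∃ a, IsZigzag (prepend a z)
    · obtain ⟨a, ha⟩ := hmax
      obtain ⟨s, ⟨h1, -, h2⟩, -⟩ := ha 0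
      have h3 : a.1 < (z 0).1 := by
        have h4 : z 0 = Triple.step s a := h2
        rw [h4]; exact lt_step_fst h1 s
      obtain ⟨w, N, hw, hwz⟩ := ih _ ha (by change a.1 ≤ n; push_cast at h; omega)
      refine ⟨w, N + 1, hw, fun i => ?_⟩
      rw [← add_assoc, add_right_comm]
      exact hwz (i + 1)
    · push Not at hmax
      exact ⟨z, 0, ⟨hz, hmax⟩, fun i => rfl⟩

/-- Maximal zigzags with a common tail have the same first node. -/
lemma maximal_eq_of_tail {w w' : ℕ → Triple} (hw : IsMaximalZigzag w) (hw' : IsMaximalZigzag w')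
    (a b : ℕ) (h : ∀ i, w (i + a) = w' (i + b)) : w 0 = w' 0 := by
  -- A zigzag which is a proper tail of another one is not maximal.
  have key : ∀ {v v' : ℕ → Triple}, IsMaximalZigzag v → IsMaximalZigzag v' → ∀ b,
      (∀ i, v i = v' (i + (b + 1))) → False := by
    intro v v' hv hv' b hb
    obtain ⟨s, hs⟩ := isZigzag_iff.mp hv'.1
    refine hv.2 (v' b) ?_
    have : prepend (v' b) v = fun i => v' (i + b) := by
      funext i
      cases i with
      | zero => simp [prepend]
      | succ i => simp only [prepend, hb]; congr 1; omega
    rw [this]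
    intro i
    obtain ⟨s, h1, h2⟩ := hv'.1 (i + b)
    refine ⟨s, ?_, ?_⟩
    · simpa only [add_right_comm] using h1
    · simpa only [add_right_comm] using h2
  induction a generalizing b with
  | zero =>
    cases b with
    | zero => exact h 0
    | succ b => exact (key hw hw' b h).elim
  | succ a ih =>
    cases b with
    | zero => exact (key hw' hw a (fun i => (h i).symm)).elim
    | succ b =>
      refine ih b (fun i => ?_)
      cases i with
      | succ i =>
        have := h i
        rw [show i + 1 + a = i + (a + 1) by omega, show i + 1 + b = i + (b + 1) by omega, this]
      | zero =>
        obtain ⟨s, h1, -⟩ := hw.1 a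
        obtain ⟨s', h2, -⟩ := hw'.1 b
        have h0 := h 0
        simp only [zero_add] at h0 ⊢
        rw [h1.2.2, h2.2.2] at h0
        exact (step_inj h1.1 h2.1 h0).2

/-- Along a zigzag, the second and third components of a node are the first components of the two
previous nodes. -/
lemma zigzag_snd {z : ℕ → Triple} (hz : IsZigzag z) (i : ℕ) :
    z (i + 2) = ((z (i + 2)).1, (z (i + 1)).1, (z i).1) ∨
      z (i + 2) = ((z (i + 2)).1, (z i).1, (z (i + 1)).1) := by
  obtain ⟨s, ⟨-, -, h1⟩, ⟨-, -, h2⟩⟩ := hz i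
  cases s
  · left; rw [h2, h1]; rfl
  · right; rw [h2, h1]; rfl

/-- A zigzag is determined by the first components of its nodes, except for its first two nodes. -/
lemma zigzag_eq_of_fst {z z' : ℕ → Triple} (hz : IsZigzag z) (hz' : IsZigzag z') {a b : ℕ}
    (h : ∀ i, (z (i + a)).1 = (z' (i + b)).1) (i : ℕ) : z (i + (a + 2)) = z' (i + (b + 2)) := by
  have tree : ∀ {z : ℕ → Triple}, IsZigzag z → ∀ i, ∃ p, tripleAt p = z (i + 2) := by
    intro z hz i
    obtain ⟨s, -, h1⟩ := hz i
    exact mem_range_of_ne_root h1.2.1 (by rw [h1.2.2]; exact step_ne_root h1.1 _)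
  obtain ⟨p, hp⟩ := tree hz (i + a)
  obtain ⟨q, hq⟩ := tree hz' (i + b)
  have e0 := h i
  have e1 := h (i + 1)
  have e2 := h (i + 2)
  rw [add_right_comm i 1, add_right_comm i 1] at e1
  rw [add_right_comm i 2, add_right_comm i 2] at e2
  rw [← add_assoc, ← add_assoc]
  have hsw := swap_ne p q
  rw [hp, hq] at hsw
  rcases zigzag_snd hz (i + a) with h1 | h1 <;> rcases zigzag_snd hz' (i + b) with h2 | h2
  · rw [h1, h2, e0, e1, e2]
  · refine absurd ?_ hsw
    rw [h2, h1, e0, e1, e2]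
  · refine absurd ?_ hsw
    rw [h2, h1, e0, e1, e2]
  · rw [h1, h2, e0, e1, e2]

/-- A sequence of integers that satisfies the recurrence of the first components of a zigzag, and
starts with a node, is the sequence of first components of a zigzag. -/
lemma exists_zigzag_of_recurrence {f : ℕ → ℤ}
    (hf : ∀ i, f (i + 3) = 3 * f (i + 2) * f (i + 1) - f i)
    (h : (f 2, f 0, f 1) ∈ Set.range tripleAt ∨ (f 2, f 1, f 0) ∈ Set.range tripleAt) :
    ∃ z, IsZigzag z ∧ (∀ i, (z i).1 = f (i + 2)) ∧ z 0 ∈ Set.range tripleAt := by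
  let node : Side → ℕ → Triple := fun s i => match s with
    | .left => (f (i + 2), f (i + 1), f i)
    | .right => (f (i + 2), f i, f (i + 1))
  have hnode : ∃ s, node s 0 ∈ Set.range tripleAt := by
    rcases h with h | h
    · exact ⟨.right, h⟩
    · exact ⟨.left, h⟩
  obtain ⟨s, hs⟩ := hnode
  have key : ∀ i, zig s (node s 0) i = node (altSide s i) i := by
    intro i
    induction i with
    | zero => rfl
    | succ i ih =>
      rw [zig, ih, altSide]
      have := hf i
      cases altSide s i <;> simp [node, Side.other, Triple.step, this]
  refine ⟨zig s (node s 0), isZigzag_iff.mpr ⟨s, zig_succ (Or.inr hs) (step_mem_range s hs)⟩,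
    fun i => ?_, hs⟩
  rw [key]
  cases altSide s i <;> rfl

/-! ### Chains of symmetric matrices -/

/-- The matrix with rows `(3, e)` and `(-e, 0)`; it is the matrix `M` for `e = 1` and its transpose
for `e = -1`. -/
def matN (e : ℤ) : Mat := !![3, e; -e, 0]

/-- A sequence of symmetric matrices of determinant `1` with
`x_{i+2} = x_{i+1} N_i x_i` where `N_i` is alternately `matN e` and `matN (-e)`, for a sign `e`. -/
structure IsChain (e : ℤ) (x : ℕ → Mat) : Prop where
  sq : e ^ 2 = 1
  symm : ∀ i, (x i).IsSymm
  det : ∀ i, (x i).det = 1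
  succ : ∀ i, x (i + 2) = x (i + 1) * matN (e * (-1) ^ i) * x i


lemma symm_apply {x : Mat} (h : x.IsSymm) : x 1 0 = x 0 1 := h.apply 0 1

lemma det_apply {x : Mat} (h : x.IsSymm) (hd : x.det = 1) : x 0 0 * x 1 1 - x 0 1 ^ 2 = 1 := by
  rw [Matrix.det_fin_two, symm_apply h] at hd
  linear_combination hd

/-- The entries of `y (matN e) x` for symmetric `x` and `y`. -/
lemma mul_matN_mul_apply {e : ℤ} {x y z : Mat} (hx : x.IsSymm) (hy : y.IsSymm)
    (h : z = y * matN e * x) :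
    z 0 0 = y 0 0 * (3 * x 0 0 + e * x 0 1) - e * y 0 1 * x 0 0 ∧
    z 0 1 = y 0 0 * (3 * x 0 1 + e * x 1 1) - e * y 0 1 * x 0 1 ∧
    z 1 0 = y 0 1 * (3 * x 0 0 + e * x 0 1) - e * y 1 1 * x 0 0 ∧
    z 1 1 = y 0 1 * (3 * x 0 1 + e * x 1 1) - e * y 1 1 * x 0 1 := by
  subst h
  simp only [Matrix.mul_apply, Fin.sum_univ_two, matN, symm_apply hx, symm_apply hy]
  simp
  refine ⟨?_, ?_, ?_, ?_⟩ <;> ring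

/-- The determinant of the coordinates of three symmetric matrices. -/
def det₃ (x y z : Mat) : ℤ :=
  x 0 0 * (y 0 1 * z 1 1 - y 1 1 * z 0 1) - x 0 1 * (y 0 0 * z 1 1 - y 1 1 * z 0 0) +
    x 1 1 * (y 0 0 * z 0 1 - y 0 1 * z 0 0)

section triple
variable {e : ℤ} {x y z : Mat}

lemma cross_snd (hx : x.IsSymm) (hy : y.IsSymm) (hz : z.IsSymm)
    (hyd : y.det = 1) (h : z = y * matN e * x) :
    z 0 0 * y 0 1 - z 0 1 * y 0 0 = e * x 0 0 := by
  obtain ⟨h1, -, h2, -⟩ := mul_matN_mul_apply hx hy h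
  have h3 := det_apply hy hyd
  rw [symm_apply hz] at h2
  rw [h1, h2]
  linear_combination e * x 0 0 * h3

lemma cross_fst (hx : x.IsSymm) (hy : y.IsSymm)
    (hxd : x.det = 1) (h : z = y * matN e * x) :
    z 0 0 * x 0 1 - z 0 1 * x 0 0 = -e * y 0 0 := by
  obtain ⟨h1, h2, -, -⟩ := mul_matN_mul_apply hx hy h
  have h3 := det_apply hx hxd
  rw [h1, h2]
  linear_combination -e * y 0 0 * h3

lemma markoff_eq (he : e ^ 2 = 1) (hx : x.IsSymm) (hy : y.IsSymm) (hz : z.IsSymm)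
    (hxd : x.det = 1) (hyd : y.det = 1) (h : z = y * matN e * x) :
    z 0 0 ^ 2 + y 0 0 ^ 2 + x 0 0 ^ 2 = 3 * z 0 0 * y 0 0 * x 0 0 := by
  have h1 := cross_snd hx hy hz hyd h
  have h2 := cross_fst hx hy hxd h
  obtain ⟨h3, -⟩ := mul_matN_mul_apply hx hy h
  have h4 : e * (z 0 0 * (x 0 0 * y 0 1 - y 0 0 * x 0 1)) = x 0 0 ^ 2 + y 0 0 ^ 2 := by
    linear_combination e * x 0 0 * h1 - e * y 0 0 * h2 + (x 0 0 ^ 2 + y 0 0 ^ 2) * he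
  linear_combination -h4 + z 0 0 * h3

/-- The determinant of consecutive elements of a chain. In particular these are linearly
independent. -/
lemma det₃_eq (hx : x.IsSymm) (hy : y.IsSymm) (hz : z.IsSymm)
    (hxd : x.det = 1) (hyd : y.det = 1) (h : z = y * matN e * x) : det₃ x y z = -2 * e := by
  obtain ⟨h1, h2, h2', h3⟩ := mul_matN_mul_apply hx hy h
  have hx' := det_apply hx hxd
  have hy' := det_apply hy hyd
  have hs : z 0 1 = z 1 0 := (symm_apply hz).symm
  rw [h2, h2'] at hs
  rw [det₃, h1, h2, h3]
  refine mul_left_cancel₀ (two_ne_zero (α := ℤ)) ?_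
  linear_combination
    (x 1 1 * y 0 0 - x 0 0 * y 1 1 + (x 0 0 * y 1 1 + x 1 1 * y 0 0 - 2 * x 0 1 * y 0 1)) * hs -
      4 * e * ((y 0 0 * y 1 1 - y 0 1 ^ 2) * hx' + hy')

end triple

namespace IsChain

variable {e : ℤ} {x : ℕ → Mat}

lemma sign_sq (h : IsChain e x) (i : ℕ) : (e * (-1) ^ i) ^ 2 = 1 := by
  rw [mul_pow, h.sq, ← pow_mul, mul_comm i, pow_mul]; norm_num

lemma tail (h : IsChain e x) (n : ℕ) : IsChain (e * (-1) ^ n) (fun i => x (i + n)) where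
  sq := h.sign_sq n
  symm i := h.symm _
  det i := h.det _
  succ i := by
    have := h.succ (i + n)
    rw [add_right_comm i n 2, add_right_comm i n 1, pow_add, mul_comm ((-1) ^ i), ← mul_assoc]
      at this
    exact this

lemma cross (h : IsChain e x) (i : ℕ) :
    x (i + 2) 0 0 * x (i + 1) 0 1 - x (i + 2) 0 1 * x (i + 1) 0 0 = e * (-1) ^ i * x i 0 0 :=
  cross_snd (h.symm _) (h.symm _) (h.symm _) (h.det _) (h.succ i)

lemma markoff (h : IsChain e x) (i : ℕ) :
    x (i + 2) 0 0 ^ 2 + x (i + 1) 0 0 ^ 2 + x i 0 0 ^ 2 =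
      3 * x (i + 2) 0 0 * x (i + 1) 0 0 * x i 0 0 :=
  markoff_eq (h.sign_sq i) (h.symm _) (h.symm _) (h.symm _) (h.det _) (h.det _) (h.succ i)

lemma fst_recurrence (h : IsChain e x) (i : ℕ) :
    x (i + 3) 0 0 = 3 * x (i + 2) 0 0 * x (i + 1) 0 0 - x i 0 0 := by
  have h1 := h.cross i
  obtain ⟨h2, -⟩ := mul_matN_mul_apply (h.symm _) (h.symm _) (h.succ (i + 1))
  have h3 := h.sign_sq i
  rw [pow_succ] at h2
  linear_combination h2 - e * (-1) ^ i * h1 - x i 0 0 * h3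

lemma det₃_ne_zero (h : IsChain e x) (i : ℕ) : det₃ (x i) (x (i + 1)) (x (i + 2)) ≠ 0 := by
  rw [det₃_eq (h.symm _) (h.symm _) (h.symm _) (h.det _) (h.det _) (h.succ i)]
  intro h0
  have := h.sign_sq i
  have h1 : e * (-1) ^ i = 0 := by linarith
  rw [h1] at this; norm_num at this

/-- The upper left coefficients do not vanish, since `-k² ≠ 1`. -/
lemma mul_fst_pos (h : IsChain e x) (i : ℕ) : 0 < x i 0 0 * x i 1 1 := by
  have := det_apply (h.symm i) (h.det i)
  nlinarith [sq_nonneg (x i 0 1)]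

lemma fst_ne_zero (h : IsChain e x) (i : ℕ) : x i 0 0 ≠ 0 :=
  left_ne_zero_of_mul (h.mul_fst_pos i).ne'

/-- Changing signs so as to make the upper left coefficients positive yields a chain. -/
lemma normalize (h : IsChain e x) : IsChain e (fun i => (x i 0 0).sign • x i) where
  sq := h.sq
  symm i := (h.symm i).smul _
  det i := by
    rw [Matrix.det_smul, h.det, Fintype.card_fin, mul_one]
    rcases lt_or_gt_of_ne (h.fst_ne_zero i) with h0 | h0
    · rw [Int.sign_eq_neg_one_of_neg h0]; norm_num
    · rw [Int.sign_eq_one_of_pos h0]; norm_num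
  succ i := by
    have hpos : 0 < x (i + 2) 0 0 * (x (i + 1) 0 0 * x i 0 0) := by
      have h1 := h.markoff i
      have h2 := sq_pos_of_ne_zero (h.fst_ne_zero i)
      nlinarith [sq_nonneg (x (i + 2) 0 0), sq_nonneg (x (i + 1) 0 0)]
    have hs : (x (i + 2) 0 0).sign = (x (i + 1) 0 0).sign * (x i 0 0).sign := by
      rw [← Int.sign_mul]
      rcases pos_and_pos_or_neg_and_neg_of_mul_pos hpos with ⟨h1, h2⟩ | ⟨h1, h2⟩
      · rw [Int.sign_eq_one_of_pos h1, Int.sign_eq_one_of_pos h2]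
      · rw [Int.sign_eq_neg_one_of_neg h1, Int.sign_eq_neg_one_of_neg h2]
    change (x (i + 2) 0 0).sign • x (i + 2) = _
    rw [hs, h.succ i]
    simp only [Matrix.smul_mul, Matrix.mul_smul, smul_smul]
    rw [mul_comm (x i 0 0).sign]

end IsChain

/-! ### Growth and convergence of increasing chains -/

/-- A chain whose upper left coefficients are increasing and at least `2`. -/
structure IsGrowing (e : ℤ) (x : ℕ → Mat) : Prop extends IsChain e x where
  two_le_zero : 2 ≤ x 0 0 0
  lt_succ : ∀ i, x i 0 0 < x (i + 1) 0 0

namespace IsGrowing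

variable {e : ℤ} {x : ℕ → Mat}

lemma strictMono (h : IsGrowing e x) : StrictMono (fun i => x i 0 0) :=
  strictMono_nat_of_lt_succ h.lt_succ

lemma two_le (h : IsGrowing e x) (i : ℕ) : 2 ≤ x i 0 0 :=
  h.two_le_zero.trans (h.strictMono.monotone (Nat.zero_le i))

lemma two_le_real (h : IsGrowing e x) (i : ℕ) : (2 : ℝ) ≤ x i 0 0 := by exact_mod_cast h.two_le i

lemma pos (h : IsGrowing e x) (i : ℕ) : (0 : ℝ) < x i 0 0 := by linarith [h.two_le_real i]

lemma tail (h : IsGrowing e x) (n : ℕ) :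
    IsGrowing (e * (-1) ^ n) (fun i => x (i + n)) where
  toIsChain := h.toIsChain.tail n
  two_le_zero := h.two_le _
  lt_succ i := by
    have := h.lt_succ (i + n)
    rwa [add_right_comm] at this

lemma mul_le (h : IsGrowing e x) (i : ℕ) : x (i + 1) 0 0 * x i 0 0 ≤ x (i + 2) 0 0 := by
  have h0 := h.two_le i
  have h1 := h.lt_succ i
  have h2 : x (i + 1) 0 0 < x (i + 2) 0 0 := h.lt_succ (i + 1)
  have h3 := h.markoff i
  generalize x i 0 0 = a at *
  generalize x (i + 1) 0 0 = b at *
  generalize x (i + 2) 0 0 = c at *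
  have h4 : c * (3 * b * a - c) = b ^ 2 + a ^ 2 := by linear_combination -h3
  have h5 : 3 * b * a - c < 2 * b := by
    by_contra hneg
    push Not at hneg
    have : c * (2 * b) ≤ c * (3 * b * a - c) := mul_le_mul_of_nonneg_left hneg (by omega)
    nlinarith
  nlinarith

lemma le_mul (h : IsGrowing e x) (i : ℕ) : x (i + 2) 0 0 ≤ 3 * (x (i + 1) 0 0 * x i 0 0) := by
  have h2 := h.two_le (i + 2)
  have h3 := h.markoff i
  generalize x i 0 0 = a at *
  generalize x (i + 1) 0 0 = b at *
  generalize x (i + 2) 0 0 = c at *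
  have h4 : c * (3 * (b * a) - c) = b ^ 2 + a ^ 2 := by linear_combination -h3
  by_contra hneg
  push Not at hneg
  have : c * (3 * (b * a) - c) < 0 := mul_neg_of_pos_of_neg (by omega) (by omega)
  nlinarith [sq_nonneg a, sq_nonneg b]

lemma mul_le_real (h : IsGrowing e x) (i : ℕ) :
    (x (i + 1) 0 0 : ℝ) * x i 0 0 ≤ x (i + 2) 0 0 := by exact_mod_cast h.mul_le i

lemma le_mul_real (h : IsGrowing e x) (i : ℕ) :
    (x (i + 2) 0 0 : ℝ) ≤ 3 * (x (i + 1) 0 0 * x i 0 0) := by exact_mod_cast h.le_mul i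

lemma double_le (h : IsGrowing e x) (i : ℕ) :
    2 * (x (i + 1) 0 0 : ℝ) ≤ x (i + 2) 0 0 := by
  nlinarith [h.mul_le_real i, h.two_le_real i, h.pos (i + 1)]

lemma two_pow_le (h : IsGrowing e x) (i : ℕ) : (2 : ℝ) ^ i ≤ x i 0 0 := by
  match i with
  | 0 => linarith [h.two_le_real 0]
  | 1 => linarith [h.two_le_real 1]
  | i + 2 =>
    have := h.two_pow_le (i + 1)
    rw [pow_succ]
    linarith [h.double_le i]

lemma tendsto_atTop (h : IsGrowing e x) : Tendsto (fun i => (x i 0 0 : ℝ)) atTop atTop :=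
  tendsto_atTop_mono h.two_pow_le (tendsto_pow_atTop_atTop_of_one_lt one_lt_two)

lemma tendsto_const_div (h : IsGrowing e x) (c : ℝ) :
    Tendsto (fun i => c / (x i 0 0 : ℝ)) atTop (𝓝 0) :=
  h.tendsto_atTop.const_div_atTop c

end IsGrowing

/-- The quotient of the coefficients of the first row of a matrix, which approximates the number
attached to a chain. -/
noncomputable def ratio (y : Mat) : ℝ := (y 0 1 : ℝ) / (y 0 0 : ℝ)

namespace IsGrowing

variable {e : ℤ} {x : ℕ → Mat}

lemma ratio_sub_le (h : IsGrowing e x) (i : ℕ) :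
    |ratio (x (i + 1)) - ratio (x (i + 2))| ≤ 1 / (x (i + 1) 0 0 : ℝ) ^ 2 := by
  have h0 := h.pos i
  have h1 := h.pos (i + 1)
  have h2 := h.pos (i + 2)
  have hc : (x (i + 2) 0 0 : ℝ) * x (i + 1) 0 1 - x (i + 2) 0 1 * x (i + 1) 0 0 =
      (e * (-1) ^ i : ℤ) * x i 0 0 := by exact_mod_cast h.cross i
  have hs : |((e * (-1) ^ i : ℤ) : ℝ)| = 1 := by
    have : ((e * (-1) ^ i : ℤ) : ℝ) ^ 2 = 1 := by exact_mod_cast h.sign_sq i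
    rw [← sq_abs] at this
    exact (pow_eq_one_iff_of_nonneg (abs_nonneg _) two_ne_zero).mp this
  have hr : ratio (x (i + 1)) - ratio (x (i + 2)) =
      (e * (-1) ^ i : ℤ) * x i 0 0 / (x (i + 1) 0 0 * x (i + 2) 0 0) := by
    rw [← hc, ratio, ratio]; field_simp
  rw [hr, abs_div, abs_mul, hs, one_mul, abs_of_pos h0, abs_of_pos (mul_pos h1 h2),
    div_le_div_iff₀ (mul_pos h1 h2) (by positivity)]
  nlinarith [h.mul_le_real i]

lemma step_bound (h : IsGrowing e x) (i : ℕ) :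
    |ratio (x (i + 1)) - ratio (x (i + 2))| ≤
      2 / (x (i + 1) 0 0 : ℝ) ^ 2 - 2 / (x (i + 2) 0 0 : ℝ) ^ 2 := by
  have h1 := h.pos (i + 1)
  have h2 := h.double_le i
  have h3 : 2 / (x (i + 2) 0 0 : ℝ) ^ 2 ≤ 2 / (2 * (x (i + 1) 0 0 : ℝ)) ^ 2 := by gcongr
  have h4 : 2 / (2 * (x (i + 1) 0 0 : ℝ)) ^ 2 = (1 / 2) * (1 / (x (i + 1) 0 0 : ℝ) ^ 2) := by
    field_simp
  have h5 : 2 / (x (i + 1) 0 0 : ℝ) ^ 2 = 2 * (1 / (x (i + 1) 0 0 : ℝ) ^ 2) := by ring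
  have h6 : 0 ≤ 1 / (x (i + 1) 0 0 : ℝ) ^ 2 := by positivity
  linarith [h.ratio_sub_le i]

/-- The quotients `k/m` of a growing chain converge. -/
lemma exists_limit (h : IsGrowing e x) :
    ∃ ξ : ℝ, Tendsto (fun i => ratio (x i)) atTop (𝓝 ξ) := by
  have hc : CauchySeq (fun i => ratio (x (i + 1))) := by
    refine cauchySeq_of_le_geometric (1 / 2) 1 (by norm_num) (fun i => ?_)
    rw [Real.dist_eq]
    refine (h.ratio_sub_le i).trans ?_
    have h1 := h.two_pow_le (i + 1)
    have h2 := h.two_le_real (i + 1)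
    rw [one_mul, one_div_pow]
    refine one_div_le_one_div_of_le (by positivity) ?_
    have : (2 : ℝ) ^ i ≤ 2 ^ (i + 1) := pow_le_pow_right₀ (by norm_num) (by omega)
    nlinarith
  obtain ⟨ξ, hξ⟩ := cauchySeq_tendsto_of_complete hc
  exact ⟨ξ, (tendsto_add_atTop_iff_nat 1).mp hξ⟩

lemma abs_sub_ratio_le (h : IsGrowing e x) {ξ : ℝ}
    (hξ : Tendsto (fun i => ratio (x i)) atTop (𝓝 ξ)) (i : ℕ) :
    |ξ - ratio (x (i + 1))| ≤ 2 / (x (i + 1) 0 0 : ℝ) ^ 2 := by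
  have key : ∀ n, |ratio (x (n + (i + 1))) - ratio (x (i + 1))| ≤
      2 / (x (i + 1) 0 0 : ℝ) ^ 2 - 2 / (x (n + (i + 1)) 0 0 : ℝ) ^ 2 := by
    intro n
    induction n with
    | zero => simp
    | succ n ih =>
      have h1 := h.step_bound (n + i)
      rw [abs_sub_comm] at h1
      have e1 : n + 1 + (i + 1) = n + i + 2 := by omega
      have e2 : n + (i + 1) = n + i + 1 := by omega
      rw [e1]; rw [e2] at ih
      have h2 := abs_sub_le (ratio (x (n + i + 2))) (ratio (x (n + i + 1))) (ratio (x (i + 1)))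
      linarith
  have ht : Tendsto (fun n => |ratio (x (n + (i + 1))) - ratio (x (i + 1))|) atTop
      (𝓝 |ξ - ratio (x (i + 1))|) :=
    ((((tendsto_add_atTop_iff_nat (i + 1)).mpr hξ)).sub_const _).abs
  refine le_of_tendsto' ht (fun n => (key n).trans ?_)
  have : 0 ≤ 2 / (x (n + (i + 1)) 0 0 : ℝ) ^ 2 := by positivity
  linarith

end IsGrowing

lemma rowNorm_apply {ξ : ℝ} {y : Mat} (hy : y.IsSymm) :
    rowNorm ξ y = max |ξ * y 0 0 - y 0 1| |ξ * y 0 1 - y 1 1| := by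
  rw [rowNorm, symm_apply hy]

lemma det_real {y : Mat} (hy : y.IsSymm) (hd : y.det = 1) :
    (y 0 0 : ℝ) * y 1 1 - (y 0 1 : ℝ) ^ 2 = 1 := by exact_mod_cast det_apply hy hd

/-- A growing chain of matrices whose coefficients are non-negative, the upper left one being the
largest. The chains which come from the Markoff tree are of this kind. -/
structure IsReduced (e : ℤ) (x : ℕ → Mat) : Prop extends IsGrowing e x where
  snd_nonneg : ∀ i, 0 ≤ x i 0 1
  snd_le : ∀ i, x i 0 1 ≤ x i 0 0

namespace IsReduced

variable {e : ℤ} {x : ℕ → Mat}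

lemma matNorm_eq (h : IsReduced e x) (i : ℕ) : matNorm (x i) = x i 0 0 := by
  have h0 := h.snd_nonneg i
  have h1 := h.snd_le i
  have h2 := h.two_le i
  have h3 := det_apply (h.symm i) (h.det i)
  have h4 : 0 ≤ x i 1 1 := by
    by_contra hneg
    have : x i 0 0 * x i 1 1 < 0 := mul_neg_of_pos_of_neg (by omega) (by omega)
    nlinarith [sq_nonneg (x i 0 1)]
  have h5 : x i 1 1 ≤ x i 0 0 := by
    by_contra hneg
    have : x i 0 0 * (x i 0 0 + 1) ≤ x i 0 0 * x i 1 1 :=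
      mul_le_mul_of_nonneg_left (by omega) (by omega)
    nlinarith
  have hk : (x i 0 1 : ℝ) ≤ x i 0 0 := by exact_mod_cast h1
  have hl : (x i 1 1 : ℝ) ≤ x i 0 0 := by exact_mod_cast h5
  rw [matNorm, symm_apply (h.symm i), abs_of_nonneg (by exact_mod_cast (by omega : 0 ≤ x i 0 0)),
    abs_of_nonneg (by exact_mod_cast h0), abs_of_nonneg (by exact_mod_cast h4),
    max_eq_left hk, max_eq_left (max_le hk hl)]

lemma rowNorm_le (h : IsReduced e x) {ξ : ℝ}
    (hξ : Tendsto (fun i => ratio (x i)) atTop (𝓝 ξ)) :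
    ∃ C : ℝ, 0 < C ∧ ∀ i, rowNorm ξ (x i) ≤ C / x i 0 0 := by
  refine ⟨max 3 (rowNorm ξ (x 0) * x 0 0 0), by positivity, fun i => ?_⟩
  have hm := h.pos i
  rw [le_div_iff₀ hm]
  cases i with
  | zero => exact le_max_right _ _
  | succ i =>
    refine le_trans ?_ (le_max_left _ _)
    have h1 := h.abs_sub_ratio_le hξ i
    have h2 := det_real (h.symm (i + 1)) (h.det (i + 1))
    have h3 : (0 : ℝ) ≤ x (i + 1) 0 1 := by exact_mod_cast h.snd_nonneg (i + 1)
    have h4 : (x (i + 1) 0 1 : ℝ) ≤ x (i + 1) 0 0 := by exact_mod_cast h.snd_le (i + 1)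
    rw [ratio] at h1
    rw [rowNorm_apply (h.symm _)]
    generalize (x (i + 1) 0 0 : ℝ) = m at *
    generalize (x (i + 1) 0 1 : ℝ) = k at *
    generalize (x (i + 1) 1 1 : ℝ) = l at *
    have h5 : |ξ * m - k| * m ≤ 2 := by
      have : |ξ * m - k| = |ξ - k / m| * m := by
        rw [← abs_of_pos hm, ← abs_mul, abs_of_pos hm]; congr 1; field_simp
      rw [this, mul_assoc, ← sq]
      calc _ ≤ 2 / m ^ 2 * m ^ 2 := by gcongr
        _ = 2 := by field_simp
    have h6 : |ξ * k - l| * m ≤ 3 := by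
      have : (ξ * k - l) * m = k * (ξ * m - k) - 1 := by linear_combination -h2
      rw [← abs_of_pos hm, ← abs_mul, this]
      refine (abs_sub _ _).trans ?_
      rw [abs_mul, abs_of_nonneg h3, abs_one]
      nlinarith [abs_nonneg (ξ * m - k)]
    rw [max_mul_of_nonneg _ _ hm.le]
    exact max_le (by linarith) h6

lemma inv_le_rowNorm (h : IsReduced e x) (ξ : ℝ) (i : ℕ) :
    (1 / 2) * (x i 0 0 : ℝ)⁻¹ ≤ rowNorm ξ (x i) := by
  have hm := h.pos i
  have h2 := det_real (h.symm i) (h.det i)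
  have h3 : (0 : ℝ) ≤ x i 0 1 := by exact_mod_cast h.snd_nonneg i
  have h4 : (x i 0 1 : ℝ) ≤ x i 0 0 := by exact_mod_cast h.snd_le i
  rw [rowNorm_apply (h.symm _)]
  generalize (x i 0 0 : ℝ) = m at *
  generalize (x i 0 1 : ℝ) = k at *
  generalize (x i 1 1 : ℝ) = l at *
  set R := max |ξ * m - k| |ξ * k - l| with hR
  have h5 : |ξ * m - k| ≤ R := le_max_left _ _
  have h6 : |ξ * k - l| ≤ R := le_max_right _ _
  have h7 : (1 : ℝ) ≤ 2 * (m * R) := by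
    have e1 : (1 : ℝ) = k * (ξ * m - k) - m * (ξ * k - l) := by linear_combination -h2
    have h8 : k * (ξ * m - k) ≤ k * R := mul_le_mul_of_nonneg_left ((le_abs_self _).trans h5) h3
    have h9 : m * (-(ξ * k - l)) ≤ m * R :=
      mul_le_mul_of_nonneg_left ((neg_le_abs _).trans h6) hm.le
    have h10 : k * R ≤ m * R := mul_le_mul_of_nonneg_right h4 ((abs_nonneg _).trans h5)
    linarith
  rw [← div_eq_mul_inv, div_le_iff₀ hm]
  linarith

end IsReduced

namespace IsGrowing

variable {e : ℤ} {x : ℕ → Mat}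

/-- The logarithms of the upper left coefficients satisfy the recurrence of Fibonacci up to a
bounded error, so that each coefficient is comparable to the previous one to the power `γ`. -/
lemma growth (h : IsGrowing e x) :
    Asymp (fun i => (x (i + 1) 0 0 : ℝ)) (fun i => (x i 0 0 : ℝ) ^ Real.goldenRatio) := by
  set γ := Real.goldenRatio with hγ
  have hγ2 : γ ^ 2 = γ + 1 := Real.goldenRatio_sq
  have hγ1 : 1 < γ := Real.one_lt_goldenRatio
  have hγ3 : γ < 2 := Real.goldenRatio_lt_two
  have hlog3 : 0 ≤ Real.log 3 := Real.log_nonneg (by norm_num)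
  set y : ℕ → ℝ := fun i => Real.log (x i 0 0) with hy
  have hrec : ∀ i, y (i + 1) + y i ≤ y (i + 2) ∧ y (i + 2) ≤ Real.log 3 + (y (i + 1) + y i) := by
    intro i
    have h0 := h.pos i
    have h1 := h.pos (i + 1)
    have h2 := h.pos (i + 2)
    simp only [hy]
    rw [← Real.log_mul h1.ne' h0.ne', ← Real.log_mul (by norm_num) (mul_pos h1 h0).ne']
    exact ⟨Real.log_le_log (mul_pos h1 h0) (h.mul_le_real i), Real.log_le_log h2 (h.le_mul_real i)⟩
  set B := |y 1 - γ * y 0| + Real.log 3 / (2 - γ) with hB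
  have hB1 : (γ - 1) * B + Real.log 3 ≤ B := by
    have : Real.log 3 = (2 - γ) * (Real.log 3 / (2 - γ)) := by
      field_simp [(by linarith : (2 - γ) ≠ 0)]
    have h2 : (2 - γ) * (Real.log 3 / (2 - γ)) ≤ (2 - γ) * B := by
      refine mul_le_mul_of_nonneg_left ?_ (by linarith)
      rw [hB]; linarith [abs_nonneg (y 1 - γ * y 0)]
    linarith
  have hb : ∀ i, |y (i + 1) - γ * y i| ≤ B := by
    intro i
    induction i with
    | zero =>
      rw [hB, zero_add]
      have : 0 ≤ Real.log 3 / (2 - γ) := div_nonneg hlog3 (by linarith)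
      linarith
    | succ i ih =>
      obtain ⟨h1, h2⟩ := hrec i
      have e1 : y (i + 2) - γ * y (i + 1) =
          -(γ - 1) * (y (i + 1) - γ * y i) + (y (i + 2) - (y (i + 1) + y i)) := by
        linear_combination -(y i) * hγ2
      rw [show i + 1 + 1 = i + 2 by rfl, e1]
      refine (abs_add_le _ _).trans (le_trans ?_ hB1)
      rw [abs_mul, abs_neg, abs_of_pos (by linarith : 0 < γ - 1),
        abs_of_nonneg (by linarith : 0 ≤ y (i + 2) - (y (i + 1) + y i))]
      have := mul_le_mul_of_nonneg_left ih (by linarith : 0 ≤ γ - 1)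
      linarith
  refine ⟨Real.exp (-B), Real.exp B, Real.exp_pos _, Real.exp_pos _, fun i => ?_⟩
  obtain ⟨h1, h2⟩ := abs_le.mp (hb i)
  have e1 : (x (i + 1) 0 0 : ℝ) = Real.exp (y (i + 1)) := (Real.exp_log (h.pos _)).symm
  have e2 : (x i 0 0 : ℝ) ^ γ = Real.exp (y i * γ) := Real.rpow_def_of_pos (h.pos i) γ
  simp only [e1, e2, ← Real.exp_add]
  exact ⟨Real.exp_le_exp.mpr (by linarith), Real.exp_le_exp.mpr (by linarith)⟩

end IsGrowing

lemma primitive_of_det_one {y : Mat} (hd : y.det = 1) : IsPrimitive y := by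
  intro d h
  rw [Matrix.det_fin_two] at hd
  exact isUnit_of_dvd_one (hd ▸ dvd_sub ((h 0 0).mul_right _) ((h 0 1).mul_right _))

namespace IsReduced

variable {e : ℤ} {x : ℕ → Mat}

lemma isMatrixSequence (h : IsReduced e x) {ξ : ℝ}
    (hξ : Tendsto (fun i => ratio (x i)) atTop (𝓝 ξ)) : IsMatrixSequence ξ x := by
  refine ⟨h.symm, fun i => primitive_of_det_one (h.det i), fun B => ?_, ?_, ?_, ?_⟩
  · obtain ⟨i, hi⟩ := (h.tendsto_atTop.eventually_gt_atTop B).exists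
    exact ⟨i, by rwa [h.matNorm_eq]⟩
  · simpa only [h.matNorm_eq] using h.growth
  · obtain ⟨C, hC, hr⟩ := h.rowNorm_le hξ
    refine ⟨1 / 2, C, by norm_num, hC, fun i => ?_⟩
    simp only [h.matNorm_eq]
    exact ⟨h.inv_le_rowNorm ξ i, by simpa only [div_eq_mul_inv] using hr i⟩
  · exact ⟨1, 1, one_pos, one_pos, fun i => by simp [h.det i]⟩

/-- If `aξ² + bξ + c = 0`, then the integers `al + bk + cm` tend to zero, hence vanish eventually,
and the linear independence of consecutive elements of the chain yields `a = b = c = 0`. -/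
lemma not_quadratic (h : IsReduced e x) {ξ : ℝ}
    (hξ : Tendsto (fun i => ratio (x i)) atTop (𝓝 ξ)) (a b c : ℤ)
    (h0 : a * ξ ^ 2 + b * ξ + c = 0) : a = 0 ∧ b = 0 ∧ c = 0 := by
  obtain ⟨C, hC, hr⟩ := h.rowNorm_le hξ
  have hev : ∀ᶠ i in atTop, a * x i 1 1 + b * x i 0 1 + c * x i 0 0 = 0 := by
    have ht := h.tendsto_const_div ((|(a : ℝ)| + |a * ξ + b|) * C)
    filter_upwards [ht.eventually_lt_const one_pos] with i hi
    have hri := hr i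
    rw [rowNorm_apply (h.symm i)] at hri
    have h1 := (le_max_left _ _).trans hri
    have h2 := (le_max_right _ _).trans hri
    have e1 : ((a * x i 1 1 + b * x i 0 1 + c * x i 0 0 : ℤ) : ℝ) =
        -(a * (ξ * x i 0 1 - x i 1 1)) - (a * ξ + b) * (ξ * x i 0 0 - x i 0 1) := by
      push_cast
      linear_combination (x i 0 0 : ℝ) * h0
    have h3 : |((a * x i 1 1 + b * x i 0 1 + c * x i 0 0 : ℤ) : ℝ)| < 1 := by
      rw [e1]
      refine (abs_sub _ _).trans_lt ?_
      rw [abs_neg, abs_mul, abs_mul]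
      refine lt_of_le_of_lt ?_ hi
      rw [mul_div_assoc, add_mul]
      gcongr
    rw [← Int.cast_abs] at h3
    exact Int.abs_lt_one_iff.mp (by exact_mod_cast h3)
  obtain ⟨n, hn⟩ := eventually_atTop.mp hev
  have e0 := hn n le_rfl
  have e1 := hn (n + 1) (by omega)
  have e2 := hn (n + 2) (by omega)
  have hD := h.det₃_ne_zero n
  refine ⟨?_, ?_, ?_⟩ <;> refine (mul_eq_zero.mp ?_).resolve_right hD <;> rw [det₃]
  · linear_combination
      (x (n + 1) 0 0 * x (n + 2) 0 1 - x (n + 1) 0 1 * x (n + 2) 0 0) * e0 -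
      (x n 0 0 * x (n + 2) 0 1 - x n 0 1 * x (n + 2) 0 0) * e1 +
      (x n 0 0 * x (n + 1) 0 1 - x n 0 1 * x (n + 1) 0 0) * e2
  · linear_combination
      -(x (n + 1) 0 0 * x (n + 2) 1 1 - x (n + 1) 1 1 * x (n + 2) 0 0) * e0 +
      (x n 0 0 * x (n + 2) 1 1 - x n 1 1 * x (n + 2) 0 0) * e1 -
      (x n 0 0 * x (n + 1) 1 1 - x n 1 1 * x (n + 1) 0 0) * e2
  · linear_combination
      (x (n + 1) 0 1 * x (n + 2) 1 1 - x (n + 1) 1 1 * x (n + 2) 0 1) * e0 -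
      (x n 0 1 * x (n + 2) 1 1 - x n 1 1 * x (n + 2) 0 1) * e1 +
      (x n 0 1 * x (n + 1) 1 1 - x n 1 1 * x (n + 1) 0 1) * e2

lemma isExtremal (h : IsReduced e x) {ξ : ℝ}
    (hξ : Tendsto (fun i => ratio (x i)) atTop (𝓝 ξ)) : IsExtremal ξ := by
  refine ⟨h.not_quadratic hξ, ?_⟩
  obtain ⟨C, hC, hr⟩ := h.rowNorm_le hξ
  obtain ⟨_, G, _, hG, hg⟩ := h.growth
  set γ := Real.goldenRatio with hγ
  have hγ1 : 1 < γ := Real.one_lt_goldenRatio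
  have hγ0 : 0 < γ := by linarith
  set c := (|ξ| + 1) ^ 2 * x 0 0 0 + (|ξ| + 1) * (C * G ^ (1 / γ)) with hc
  have hm0 := h.pos 0
  have hG' : 0 < G ^ (1 / γ) := Real.rpow_pos_of_pos hG _
  have hξ0 := abs_nonneg ξ
  refine ⟨c, by positivity, fun X hX => ?_⟩
  have hX0 : 0 < X := by linarith
  have hXp : 0 < X ^ (-(1 / γ)) := Real.rpow_pos_of_pos hX0 _
  by_cases hX1 : X < x 0 0 0
  · have h1 : 1 ≤ x 0 0 0 * X ^ (-(1 / γ)) := by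
      rw [Real.rpow_neg hX0.le, ← div_eq_mul_inv, le_div_iff₀ (Real.rpow_pos_of_pos hX0 _), one_mul]
      calc X ^ (1 / γ) ≤ X ^ (1 : ℝ) :=
            Real.rpow_le_rpow_of_exponent_le hX ((div_le_one hγ0).mpr hγ1.le)
        _ = X := Real.rpow_one X
        _ ≤ _ := hX1.le
    have h2 : (|ξ| + 1) ^ 2 ≤ c * X ^ (-(1 / γ)) := by
      calc (|ξ| + 1) ^ 2 = (|ξ| + 1) ^ 2 * 1 := by ring
        _ ≤ (|ξ| + 1) ^ 2 * (x 0 0 0 * X ^ (-(1 / γ))) := by gcongr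
        _ = ((|ξ| + 1) ^ 2 * x 0 0 0) * X ^ (-(1 / γ)) := by ring
        _ ≤ c * X ^ (-(1 / γ)) := by
          refine mul_le_mul_of_nonneg_right ?_ hXp.le
          rw [hc]
          have : 0 ≤ (|ξ| + 1) * (C * G ^ (1 / γ)) := by positivity
          linarith
    refine ⟨1, 0, 0, by simp, by simpa using hX, le_trans ?_ h2, le_trans ?_ h2⟩
    · simp only [Int.cast_one, Int.cast_zero, one_mul, sub_zero]; nlinarith
    · simp only [Int.cast_one, Int.cast_zero, one_mul, sub_zero, abs_pow]; nlinarith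
  · have hex : ∃ n, X < x n 0 0 := (h.tendsto_atTop.eventually_gt_atTop X).exists
    obtain ⟨i, hi⟩ : ∃ i, Nat.find hex = i + 1 :=
      Nat.exists_eq_succ_of_ne_zero (fun h0 => hX1 (h0 ▸ Nat.find_spec hex))
    have hi1 : X < x (i + 1) 0 0 := hi ▸ Nat.find_spec hex
    have hi0 : (x i 0 0 : ℝ) ≤ X := not_lt.mp (Nat.find_min hex (by omega))
    have hm := h.pos i
    have h1 : 1 / (x i 0 0 : ℝ) ≤ G ^ (1 / γ) * X ^ (-(1 / γ)) := by
      have h2 : X ≤ G * (x i 0 0 : ℝ) ^ γ := hi1.le.trans (hg i).2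
      have h3 : X ^ (1 / γ) ≤ G ^ (1 / γ) * x i 0 0 := by
        calc X ^ (1 / γ) ≤ (G * (x i 0 0 : ℝ) ^ γ) ^ (1 / γ) :=
              Real.rpow_le_rpow hX0.le h2 (by positivity)
          _ = G ^ (1 / γ) * x i 0 0 := by
              rw [Real.mul_rpow hG.le (by positivity), ← Real.rpow_mul hm.le,
                mul_one_div_cancel hγ0.ne', Real.rpow_one]
      rw [Real.rpow_neg hX0.le, ← div_eq_mul_inv, div_le_div_iff₀ hm (Real.rpow_pos_of_pos hX0 _)]
      linarith
    have h4 : rowNorm ξ (x i) ≤ C * G ^ (1 / γ) * X ^ (-(1 / γ)) := by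
      refine (hr i).trans ?_
      rw [div_eq_mul_one_div, mul_assoc]
      gcongr
    rw [rowNorm_apply (h.symm i)] at h4
    have h5 := (le_max_left _ _).trans h4
    have h6 := (le_max_right _ _).trans h4
    have h7 : (|ξ| + 1) * (C * G ^ (1 / γ) * X ^ (-(1 / γ))) ≤ c * X ^ (-(1 / γ)) := by
      rw [hc]
      have : 0 ≤ (|ξ| + 1) ^ 2 * x 0 0 0 * X ^ (-(1 / γ)) := by positivity
      nlinarith
    set E := C * G ^ (1 / γ) * X ^ (-(1 / γ)) with hE
    have hE0 : 0 ≤ E := by positivity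
    refine ⟨x i 0 0, x i 0 1, x i 1 1, ?_, ?_, ?_, ?_⟩
    · have := h.two_le i
      intro h0
      rw [Prod.mk.injEq] at h0
      omega
    · rwa [abs_of_pos hm]
    · rw [mul_comm]
      nlinarith
    · have e1 : (x i 0 0 : ℝ) * ξ ^ 2 - x i 1 1 =
          ξ * (ξ * x i 0 0 - x i 0 1) + (ξ * x i 0 1 - x i 1 1) := by ring
      rw [e1]
      refine (abs_add_le _ _).trans (le_trans ?_ h7)
      rw [abs_mul]
      nlinarith [mul_le_mul_of_nonneg_left h5 hξ0]

end IsReduced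

/-! ### The matrices attached to the nodes of the tree -/

lemma matN_one : matN 1 = matM := by simp [matN, matM]

lemma matN_neg_one : matN (-1) = matM.transpose := by
  ext i j; fin_cases i <;> fin_cases j <;> simp [matN, matM]

lemma det_matM : matM.det = 1 := by simp [matM, Matrix.det_fin_two]

/-- A symmetric integral matrix of determinant `1` with upper left coefficient `m > 0` whose
quotient `k/m` lies in the interval `[1/2, 1]`. -/
structure IsMarkoffMat (m : ℤ) (x : Mat) : Prop where
  symm : x.IsSymm
  det : x.det = 1
  fst : x 0 0 = m
  pos : 0 < m
  snd_le : x 0 1 ≤ m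
  le_snd : m ≤ 2 * x 0 1

/-- The interval `[1/2, 1]` of the quotients `k/m` is stable under the formation of products
`y M x`, for then the new quotient lies between those of `x` and `y`. -/
lemma IsMarkoffMat.mul {m n p : ℤ} {x y : Mat} (hx : IsMarkoffMat m x) (hy : IsMarkoffMat n y)
    (hs : (y * matM * x).IsSymm) (hp : 0 < p) (h : (y * matM * x) 0 0 = p) :
    IsMarkoffMat p (y * matM * x) := by
  obtain ⟨hx1, hx2, hx3, hx4, hx5, hx6⟩ := hx
  obtain ⟨hy1, hy2, hy3, hy4, hy5, hy6⟩ := hy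
  have hz : y * matM * x = y * matN 1 * x := by rw [matN_one]
  have h1 := cross_snd hx1 hy1 hs hy2 hz
  have h2 := cross_fst hx1 hy1 hx2 hz
  rw [h, hx3, hy3] at h1 h2
  generalize hw : y * matM * x = z at *
  refine ⟨hs, ?_, h, hp, ?_, ?_⟩
  · rw [← hw, Matrix.det_mul, Matrix.det_mul, hx2, hy2, det_matM]; norm_num
  · have : z 0 1 * n ≤ p * n := by nlinarith
    exact le_of_mul_le_mul_right this hy4
  · have : p * m ≤ 2 * z 0 1 * m := by nlinarith
    exact le_of_mul_le_mul_right this hx4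

lemma matAt_spec (p : List Side) :
    IsMarkoffMat (tripleAt p).1 (matAt p).1 ∧ IsMarkoffMat (tripleAt p).2.1 (matAt p).2.1 ∧
      IsMarkoffMat (tripleAt p).2.2 (matAt p).2.2 ∧
      (matAt p).1 = (matAt p).2.1 * matM * (matAt p).2.2 := by
  have symm2 : ∀ a b c : ℤ, (!![a, b; b, c] : Mat).IsSymm := by
    intro a b c
    ext i j; fin_cases i <;> fin_cases j <;> rfl
  induction p with
  | nil =>
    refine ⟨⟨symm2 _ _ _, ?_, ?_, ?_, ?_, ?_⟩, ⟨symm2 _ _ _, ?_, ?_, ?_, ?_, ?_⟩,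
      ⟨symm2 _ _ _, ?_, ?_, ?_, ?_, ?_⟩, ?_⟩ <;>
      simp [tripleAt, matAt, Matrix.det_fin_two, matM]
  | cons s p ih =>
    obtain ⟨hx, hx1, hx2, hM⟩ := ih
    have hpos := (spec_of_mem (range_subset_sigmaStar (s :: p)))
    have hM' : (matAt p).1 = (matAt p).2.1 * matN 1 * (matAt p).2.2 := by rw [matN_one, hM]
    have c1 := cross_snd hx2.symm hx1.symm hx.symm hx1.det hM'
    have c2 := cross_fst hx2.symm hx1.symm hx2.det hM'
    have hMt : (matAt p).1 = (matAt p).2.2 * matM.transpose * (matAt p).2.1 := by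
      rw [← hx.symm, hM, Matrix.transpose_mul, Matrix.transpose_mul, hx1.symm, hx2.symm,
        Matrix.mul_assoc]
    rw [hx.fst, hx1.fst, hx2.fst] at c1 c2
    simp only [tripleAt] at hpos ⊢
    generalize tripleAt p = t at *
    simp only [matAt]
    generalize matAt p = X at *
    obtain ⟨x, x₁, x₂⟩ := X
    obtain ⟨m, m₁, m₂⟩ := t
    simp only at hx hx1 hx2 hM hMt c1 c2
    cases s <;> simp only [Triple.step, matStep] at hpos ⊢
    · have e1 : x₁ * matM * x = x₁ * matN 1 * x := by rw [matN_one]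
      have e2 := (mul_matN_mul_apply hx.symm hx1.symm e1).1
      rw [hx.fst, hx1.fst] at e2
      refine ⟨hx.mul hx1 ?_ (by omega) (by linear_combination e2 - c1), hx1, hx, trivial⟩
      have e3 : x₁ * matM * x = x₁ * matM * x₂ * matM.transpose * x₁ := by
        rw [hMt]; simp only [Matrix.mul_assoc]
      rw [e3, Matrix.IsSymm]
      simp only [Matrix.transpose_mul, Matrix.transpose_transpose, hx1.symm.eq, hx2.symm.eq,
        Matrix.mul_assoc]
    · have e1 : x * matM * x₂ = x * matN 1 * x₂ := by rw [matN_one]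
      have e2 := (mul_matN_mul_apply hx2.symm hx.symm e1).1
      rw [hx.fst, hx2.fst] at e2
      refine ⟨hx2.mul hx ?_ (by omega) (by linear_combination e2 + c2), hx, hx2, trivial⟩
      have e3 : x * matM * x₂ = x₂ * matM.transpose * x₁ * matM * x₂ := by
        rw [hMt]
      rw [e3, Matrix.IsSymm]
      simp only [Matrix.transpose_mul, Matrix.transpose_transpose, hx1.symm.eq, hx2.symm.eq,
        Matrix.mul_assoc]

lemma xMat_spec {m : Triple} (hm : m ∈ SigmaStar) : IsMarkoffMat m.1 (xMat m) := by
  rcases hm with rfl | ⟨p, rfl⟩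
  · rw [xMat_root]
    exact (matAt_spec []).2.2.1
  · rw [xMat_tripleAt]
    exact (matAt_spec p).1

/-- The sign `1` for the left side and `-1` for the right side. -/
def Side.sign : Side → ℤ
  | .left => 1
  | .right => -1

lemma sign_altSide (s : Side) (i : ℕ) : (altSide s i).sign = s.sign * (-1) ^ i := by
  induction i with
  | zero => simp [altSide]
  | succ i ih =>
    rw [pow_succ, ← mul_assoc, ← ih, altSide]
    cases altSide s i <;> rfl

lemma xMat_step {s : Side} {t n : Triple} (h : IsSuccessor s t n) :
    xMat (Triple.step s.other (Triple.step s t)) =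
      xMat (Triple.step s t) * matN s.sign * xMat t := by
  rcases id h.1 with rfl | ⟨p, rfl⟩
  · obtain rfl := root_side h
    change xMat (tripleAt [.right]) = xMat (tripleAt []) * matN 1 * _
    rw [matN_one, xMat_tripleAt, xMat_tripleAt, xMat_root]
    rfl
  · change xMat (tripleAt (s.other :: s :: p)) = xMat (tripleAt (s :: p)) * _ * _
    rw [xMat_tripleAt, xMat_tripleAt, xMat_tripleAt]
    cases s
    · rw [Side.sign, matN_one]; rfl
    · rw [Side.sign, matN_neg_one, ← (matAt_spec _).1.symm.eq]
      change ((matAt p).1 * matM * (matAt (.right :: p)).1).transpose = _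
      rw [Matrix.transpose_mul, Matrix.transpose_mul, (matAt_spec _).1.symm.eq,
        (matAt_spec _).1.symm.eq, Matrix.mul_assoc]

/-- The matrices attached to the nodes of a zigzag form a reduced chain. -/
lemma IsZigzag.isReduced {z : ℕ → Triple} (hz : IsZigzag z) :
    ∃ e, IsReduced e (fun i => xMat (z i)) := by
  obtain ⟨s, hs⟩ := isZigzag_iff.mp hz
  have hx := fun i => xMat_spec (hz.mem i)
  refine ⟨s.sign, ⟨⟨⟨?_, fun i => (hx i).symm, fun i => (hx i).det, fun i => ?_⟩, ?_, fun i => ?_⟩,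
    fun i => ?_, fun i => ?_⟩⟩
  · cases s <;> rfl
  · have h2 : z (i + 2) = Triple.step (altSide s i).other (z (i + 1)) := (hs (i + 1)).2.2
    rw [h2, (hs i).2.2, xMat_step (hs i), sign_altSide]
  · have := spec_of_mem (hz.mem 0)
    rw [(hx 0).fst]; omega
  · rw [(hx i).fst, (hx (i + 1)).fst, (hs i).2.2]
    exact lt_step_fst (hz.mem i) _
  · have h1 := (hx i).pos
    have h2 := (hx i).le_snd
    omega
  · rw [(hx i).fst]; exact (hx i).snd_le

/-! ### Elements of `E₃⁺` as limits of chains -/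

/-- Growing chains with the same upper left coefficients `m_i` have, up to a sign and the addition of
an integer, the same limit: the coefficients `k_i` are determined by the differences
`k_{i+1} / m_{i+1} - k_{i+2} / m_{i+2} = ± m_i / (m_{i+1} m_{i+2})` up to a constant. -/
lemma limit_eq_of_fst_eq {e e' : ℤ} {x x' : ℕ → Mat} (h : IsGrowing e x) (h' : IsGrowing e' x')
    (hm : ∀ i, x i 0 0 = x' i 0 0) (hc : IsCoprime (x 1 0 0) (x 2 0 0)) {ξ ξ' : ℝ}
    (hξ : Tendsto (fun i => ratio (x i)) atTop (𝓝 ξ))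
    (hξ' : Tendsto (fun i => ratio (x' i)) atTop (𝓝 ξ')) :
    ∃ s t : ℤ, s ^ 2 = 1 ∧ ξ = s * ξ' + t := by
  have hδ : ∀ i, (x (i + 1) 0 1 - e * e' * x' (i + 1) 0 1) * x (i + 2) 0 0 =
      (x (i + 2) 0 1 - e * e' * x' (i + 2) 0 1) * x (i + 1) 0 0 := by
    intro i
    have h1 := h.cross i
    have h2 := h'.cross i
    rw [← hm, ← hm, ← hm] at h2
    linear_combination h1 - e * e' * h2 - e * (-1) ^ i * x i 0 0 * h'.sq
  obtain ⟨t, ht⟩ : x 1 0 0 ∣ x 1 0 1 - e * e' * x' 1 0 1 :=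
    hc.dvd_of_dvd_mul_right ⟨_, (hδ 0).trans (mul_comm _ _)⟩
  have hall : ∀ i, x (i + 1) 0 1 - e * e' * x' (i + 1) 0 1 = x (i + 1) 0 0 * t := by
    intro i
    induction i with
    | zero => exact ht
    | succ i ih =>
      have h1 := hδ i
      rw [ih] at h1
      refine mul_right_cancel₀ (h.fst_ne_zero (i + 1)) ?_
      linear_combination -h1
  refine ⟨e * e', t, by rw [mul_pow, h.sq, h'.sq]; norm_num, ?_⟩
  refine tendsto_nhds_unique ((tendsto_add_atTop_iff_nat 1).mpr hξ) ?_
  have h2 := (((tendsto_add_atTop_iff_nat 1).mpr hξ').const_mul ((e * e' : ℤ) : ℝ)).add_const (t : ℝ)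
  refine h2.congr (fun i => ?_)
  have h3 : (x (i + 1) 0 1 : ℝ) - e * e' * x' (i + 1) 0 1 = x (i + 1) 0 0 * t := by
    exact_mod_cast hall i
  have h4 := (h.pos (i + 1)).ne'
  rw [ratio, ratio, ← hm]
  push_cast
  field_simp
  linear_combination -h3

lemma matE_eq (j : ℕ) : matE 3 (j + 2) = matN (1 * (-1) ^ j) := by
  rw [matE, matN, pow_add _ j 2, show j + 2 + 1 = j + 3 by rfl, pow_add _ j 3]
  norm_num

/-- The upper left coefficients of a sequence of matrices corresponding to a number dominate the
other ones. -/
lemma exists_fst_gt {η : ℝ} {x : ℕ → Mat} (h : IsMatrixSequence η x) {C : ℝ} (hC : 0 < C)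
    (hC' : ∀ i, |η * x i 0 0 - x i 0 1| ≤ C ∧ |η * x i 0 1 - x i 1 1| ≤ C) (B : ℝ) :
    ∃ i, B < |(x i 0 0 : ℝ)| := by
  obtain ⟨i, hi⟩ := h.2.2.1 ((1 + |η| + |η| ^ 2) * B + C * (2 + |η|))
  refine ⟨i, ?_⟩
  by_contra hneg
  push Not at hneg
  obtain ⟨h1, h2⟩ := hC' i
  rw [matNorm, symm_apply (h.1 i)] at hi
  generalize (x i 0 0 : ℝ) = m at *
  generalize (x i 0 1 : ℝ) = k at *
  generalize (x i 1 1 : ℝ) = l at *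
  have hB : 0 ≤ B := (abs_nonneg _).trans hneg
  have hη := abs_nonneg η
  have hk : |k| ≤ |η| * B + C := by
    have e1 : k = η * m - (η * m - k) := by ring
    rw [e1]
    refine (abs_sub _ _).trans (add_le_add ?_ h1)
    rw [abs_mul]; gcongr
  have hl : |l| ≤ |η| * (|η| * B + C) + C := by
    have e1 : l = η * k - (η * k - l) := by ring
    rw [e1]
    refine (abs_sub _ _).trans (add_le_add ?_ h2)
    rw [abs_mul]; gcongr
  have hηB : 0 ≤ |η| * B := by positivity
  have hηηB : 0 ≤ |η| ^ 2 * B := by positivity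
  have hηC : 0 ≤ |η| * C := by positivity
  refine absurd hi (not_lt.mpr (max_le (max_le ?_ ?_) (max_le ?_ ?_))) <;> nlinarith

/-- Each element of `E₃⁺` is the limit of a growing chain whose upper left coefficients are the
first components of the nodes of a zigzag. -/
lemma exists_zigzag_of_mem_EPlus {η : ℝ} (hη : η ∈ EPlus 3) :
    ∃ (z : ℕ → Triple) (e : ℤ) (x : ℕ → Mat), IsZigzag z ∧ IsGrowing e x ∧
      (∀ i, x i 0 0 = (z i).1) ∧ Tendsto (fun i => ratio (x i)) atTop (𝓝 η) := by
  obtain ⟨-, y, hy, hdet, hrec⟩ := hη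
  have hch : IsChain 1 y :=
    ⟨by norm_num, hy.1, hdet, fun i => by rw [hrec, matE_eq]⟩
  obtain ⟨_, C, _, hC, hr⟩ := hy.2.2.2.2.1
  have hfst : ∀ i, (1 : ℝ) ≤ |(y i 0 0 : ℝ)| := by
    intro i
    rw [← Int.cast_abs]
    exact_mod_cast Int.one_le_abs (hch.fst_ne_zero i)
  have hrow : ∀ i, |η * y i 0 0 - y i 0 1| ≤ C ∧ |η * y i 0 1 - y i 1 1| ≤ C := by
    intro i
    have h1 : rowNorm η (y i) ≤ C := by
      refine (hr i).2.trans (mul_le_of_le_one_right hC.le (inv_le_one_of_one_le₀ ?_))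
      exact (hfst i).trans ((le_max_left _ _).trans (le_max_left _ _))
    rw [rowNorm_apply (hy.1 i)] at h1
    exact ⟨(le_max_left _ _).trans h1, (le_max_right _ _).trans h1⟩
  set u : ℕ → Mat := fun i => (y i 0 0).sign • y i with hu
  have hn : IsChain 1 u := hch.normalize
  have hu0 : ∀ i, u i 0 0 = |y i 0 0| := fun i => Int.sign_mul_self_eq_abs _
  have hpos : ∀ i, 0 < u i 0 0 := fun i => by rw [hu0]; exact abs_pos.mpr (hch.fst_ne_zero i)
  have hratio : ∀ i, ratio (u i) = ratio (y i) := by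
    intro i
    have : (((y i 0 0).sign : ℤ) : ℝ) ≠ 0 :=
      Int.cast_ne_zero.mpr (mt Int.sign_eq_zero_iff_zero.mp (hch.fst_ne_zero i))
    change (((y i 0 0).sign * y i 0 1 : ℤ) : ℝ) / (((y i 0 0).sign * y i 0 0 : ℤ) : ℝ) = _
    rw [Int.cast_mul, Int.cast_mul, mul_div_mul_left _ _ this, ratio]
  -- The first index at which the upper left coefficient exceeds the first two of them (and `2`)
  -- gives the largest component of a solution of Markoff's equation.
  have hex : ∃ i, max (max (u 0 0 0) (u 1 0 0)) 2 < u i 0 0 := by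
    obtain ⟨i, hi⟩ := exists_fst_gt hy hC hrow ((max (max (u 0 0 0) (u 1 0 0)) 2 : ℤ) : ℝ)
    refine ⟨i, ?_⟩
    rw [hu0 i]
    rw [← Int.cast_abs] at hi
    exact Int.cast_lt.mp hi
  have hspec := Nat.find_spec hex
  have hmin : ∀ j < Nat.find hex, u j 0 0 ≤ max (max (u 0 0 0) (u 1 0 0)) 2 :=
    fun j hj => not_lt.mp (Nat.find_min hex hj)
  obtain ⟨n, hfind⟩ : ∃ n, Nat.find hex = n + 2 := by
    refine Nat.exists_eq_add_of_le' ?_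
    by_contra hlt
    have : Nat.find hex = 0 ∨ Nat.find hex = 1 := by omega
    rcases this with h0 | h0 <;> rw [h0] at hspec <;> omega
  rw [hfind] at hspec hmin
  have h0 := hmin n (by omega)
  have h1 := hmin (n + 1) (by omega)
  have htree := mem_tree_of_markoff' (a := u (n + 2) 0 0) (b := u n 0 0) (c := u (n + 1) 0 0)
    (by omega) (hpos _) (hpos _) (by omega) (by omega) (by linear_combination hn.markoff n)
  obtain ⟨z, hz, hzf, hz0⟩ := exists_zigzag_of_recurrence (f := fun i => u (i + n) 0 0)
    (fun i => by
      have := hn.fst_recurrence (i + n)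
      rw [add_right_comm i n 3, add_right_comm i n 2, add_right_comm i n 1] at this
      exact this)
    (by
      simp only [zero_add]
      rw [add_comm 2 n, add_comm 1 n]
      exact htree)
  have hzf' : ∀ i, u (i + (n + 2)) 0 0 = (z i).1 := by
    intro i
    rw [hzf, ← add_assoc, add_right_comm]
  have hg : IsGrowing (1 * (-1) ^ (n + 2)) (fun i => u (i + (n + 2))) := by
    refine ⟨hn.tail _, ?_, fun i => ?_⟩
    · have := spec_of_mem (hz.mem 0)
      rw [hzf']; omega
    · rw [hzf', hzf']
      obtain ⟨s, hs, -⟩ := hz i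
      rw [hs.2.2]
      exact lt_step_fst hs.1 s
  refine ⟨z, _, _, hz, hg, hzf', ?_⟩
  have h3 : Tendsto (fun i => ratio (u (i + (n + 2))) - η) atTop (𝓝 0) := by
    refine squeeze_zero_norm (fun i => ?_) (hg.tendsto_const_div C)
    have hp : (0 : ℝ) < u (i + (n + 2)) 0 0 := hg.pos i
    change ‖ratio (u (i + (n + 2))) - η‖ ≤ C / (u (i + (n + 2)) 0 0 : ℝ)
    rw [hratio, Real.norm_eq_abs, abs_sub_comm, le_div_iff₀ hp, hu0, Int.cast_abs, ← abs_mul]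
    have hne : (y (i + (n + 2)) 0 0 : ℝ) ≠ 0 := Int.cast_ne_zero.mpr (hch.fst_ne_zero _)
    have e1 : (η - ratio (y (i + (n + 2)))) * (y (i + (n + 2)) 0 0 : ℝ) =
        η * y (i + (n + 2)) 0 0 - y (i + (n + 2)) 0 1 := by
      rw [ratio]; field_simp
    rw [e1]
    exact (hrow _).1
  simpa using h3.add_const η

/-! ### Uniqueness of the chain attached to a number -/

/-- The determinant of three symmetric matrices whose rows `(ξ, -1) x` are small vanishes, being an
integer of absolute value less than `1`. -/
lemma det₃_eq_zero {ξ K : ℝ} (hK : 0 < K) {x y z : Mat} (hx : x.IsSymm) (hy : y.IsSymm)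
    (hz : z.IsSymm) (hx0 : (0 : ℝ) < x 0 0) (hy0 : (0 : ℝ) < y 0 0) (hz0 : (0 : ℝ) < z 0 0)
    (hxr : rowNorm ξ x ≤ K / x 0 0) (hyr : rowNorm ξ y ≤ K / y 0 0) (hzr : rowNorm ξ z ≤ K / z 0 0)
    (h1 : 6 * K ^ 2 * x 0 0 < y 0 0 * z 0 0) (h2 : 6 * K ^ 2 * y 0 0 < x 0 0 * z 0 0)
    (h3 : 6 * K ^ 2 * z 0 0 < x 0 0 * y 0 0) : det₃ x y z = 0 := by
  rw [rowNorm_apply hx] at hxr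
  rw [rowNorm_apply hy] at hyr
  rw [rowNorm_apply hz] at hzr
  have hxa := (le_max_left _ _).trans hxr
  have hxb := (le_max_right _ _).trans hxr
  have hya := (le_max_left _ _).trans hyr
  have hyb := (le_max_right _ _).trans hyr
  have hza := (le_max_left _ _).trans hzr
  have hzb := (le_max_right _ _).trans hzr
  have minor : ∀ {a b c p p' q q' : ℝ}, 0 < a → 0 < b → 0 < c → |p| ≤ K / b → |p'| ≤ K / b →
      |q| ≤ K / c → |q'| ≤ K / c → 6 * K ^ 2 * a < b * c → |a * (p * q' - p' * q)| < 1 / 3 := by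
    intro a b c p p' q q' ha hb hc hp hp' hq hq' h
    have e1 : |p * q' - p' * q| ≤ 2 * (K / b * (K / c)) := by
      refine (abs_sub _ _).trans ?_
      rw [abs_mul, abs_mul, two_mul]
      have := div_nonneg hK.le hb.le
      gcongr
    rw [abs_mul, abs_of_pos ha]
    calc a * |p * q' - p' * q| ≤ a * (2 * (K / b * (K / c))) := by gcongr
      _ = (6 * K ^ 2 * a) / (b * c) / 3 := by field_simp; norm_num
      _ < 1 / 3 := by
        have : (6 * K ^ 2 * a) / (b * c) < 1 := (div_lt_one (mul_pos hb hc)).mpr h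
        linarith
  have m1 := minor hx0 hy0 hz0 hya hyb hza hzb h1
  have m2 := minor hy0 hx0 hz0 hxa hxb hza hzb h2
  have m3 := minor hz0 hx0 hy0 hxa hxb hya hyb h3
  have e1 : ((det₃ x y z : ℤ) : ℝ) =
      x 0 0 * ((ξ * y 0 0 - y 0 1) * (ξ * z 0 1 - z 1 1) -
        (ξ * y 0 1 - y 1 1) * (ξ * z 0 0 - z 0 1)) -
      y 0 0 * ((ξ * x 0 0 - x 0 1) * (ξ * z 0 1 - z 1 1) -
        (ξ * x 0 1 - x 1 1) * (ξ * z 0 0 - z 0 1)) +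
      z 0 0 * ((ξ * x 0 0 - x 0 1) * (ξ * y 0 1 - y 1 1) -
        (ξ * x 0 1 - x 1 1) * (ξ * y 0 0 - y 0 1)) := by
    rw [det₃]; push_cast; ring
  have h4 : |((det₃ x y z : ℤ) : ℝ)| < 1 := by
    rw [e1, abs_lt]
    rw [abs_lt] at m1 m2 m3
    constructor <;> linarith [m1.1, m1.2, m2.1, m2.2, m3.1, m3.2]
  rw [← Int.cast_abs] at h4
  exact Int.abs_lt_one_iff.mp (by exact_mod_cast h4)

/-- A symmetric matrix in the intersection of the planes spanned by `u, v` and by `v, w` is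
proportional to `v`, hence equal to `v` if it has the same determinant and a coefficient of the same
sign. -/
lemma eq_of_det₃_eq_zero {u v w y : Mat} (hv : v.IsSymm) (hy : y.IsSymm) (hvd : v.det = 1)
    (hyd : y.det = 1) (hv0 : 0 < v 0 0) (hy0 : 0 < y 0 0) (hD : det₃ u v w ≠ 0)
    (h1 : det₃ u v y = 0) (h2 : det₃ v w y = 0) : y = v := by
  have c0 : det₃ u v w * y 0 0 = det₃ u y w * v 0 0 := by
    simp only [det₃] at *; linear_combination u 0 0 * h2 + w 0 0 * h1
  have c1 : det₃ u v w * y 0 1 = det₃ u y w * v 0 1 := by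
    simp only [det₃] at *; linear_combination u 0 1 * h2 + w 0 1 * h1
  have c2 : det₃ u v w * y 1 1 = det₃ u y w * v 1 1 := by
    simp only [det₃] at *; linear_combination u 1 1 * h2 + w 1 1 * h1
  have dv := det_apply hv hvd
  have dy := det_apply hy hyd
  generalize det₃ u v w = D at *
  generalize det₃ u y w = E at *
  have hDE : D ^ 2 = E ^ 2 := by
    linear_combination D * y 0 0 * c2 + E * v 1 1 * c0 - (D * y 0 1 + E * v 0 1) * c1 -
      D ^ 2 * dy + E ^ 2 * dv
  have hE : D = E := by
    rcases sq_eq_sq_iff_eq_or_eq_neg.mp hDE with h | h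
    · exact h
    · exfalso
      have : D * (y 0 0 + v 0 0) = 0 := by rw [h] at c0 ⊢; linear_combination c0
      rcases mul_eq_zero.mp this with h | h
      · exact hD h
      · omega
  rw [← hE] at c0 c1 c2
  have e0 := mul_left_cancel₀ hD c0
  have e1 := mul_left_cancel₀ hD c1
  have e2 := mul_left_cancel₀ hD c2
  ext i j
  fin_cases i <;> fin_cases j
  · exact e0
  · exact e1
  · change y 1 0 = v 1 0
    rw [symm_apply hv, symm_apply hy, e1]
  · exact e2

namespace IsReduced

variable {e : ℤ} {x : ℕ → Mat}

/-- Up to finitely many exceptions, all very good approximations to the limit of a reduced chain,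
that is the symmetric matrices `y` of determinant `1` with `‖(ξ,-1)y‖ ≪ ‖y‖⁻¹`, belong to the
chain. Indeed, if the upper left coefficient of `y` is between those of `x_i` and `x_{i+1}`, then `y`
is linearly dependent on `x_i` and `x_{i+1}`, and, according as it is small or large in this
interval, it is also linearly dependent on `x_{i-1}` and `x_i`, or on `x_{i+1}` and `x_{i+2}`. -/
lemma exists_eq (h : IsReduced e x) {ξ : ℝ} (hξ : Tendsto (fun i => ratio (x i)) atTop (𝓝 ξ))
    (C : ℝ) : ∃ A : ℝ, ∀ y : Mat, y.IsSymm → y.det = 1 → A ≤ y 0 0 → rowNorm ξ y ≤ C / y 0 0 →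
      ∃ i, y = x i := by
  obtain ⟨C₀, hC₀, hr⟩ := h.rowNorm_le hξ
  set K := max C₀ C with hKdef
  have hK : 0 < K := hC₀.trans_le (le_max_left _ _)
  have hxr : ∀ i, rowNorm ξ (x i) ≤ K / x i 0 0 := fun i =>
    (hr i).trans (div_le_div_of_nonneg_right (le_max_left _ _) (h.pos i).le)
  set L := 6 * K ^ 2 with hL
  have hL0 : 0 < L := by positivity
  obtain ⟨N, hN⟩ :=
    eventually_atTop.mp (h.tendsto_atTop.eventually_gt_atTop (12 * L ^ 2 + 3 * L))
  refine ⟨x (N + 2) 0 0, fun y hy hyd hyA hyr => ?_⟩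
  have hy0 : (0 : ℝ) < y 0 0 := (h.pos _).trans_le hyA
  have hyr' : rowNorm ξ y ≤ K / y 0 0 :=
    hyr.trans (div_le_div_of_nonneg_right (le_max_right _ _) hy0.le)
  have hex : ∃ n, (y 0 0 : ℝ) < x n 0 0 := (h.tendsto_atTop.eventually_gt_atTop _).exists
  have hfind : N + 2 < Nat.find hex := by
    by_contra hle
    have h1 := Nat.find_spec hex
    have h2 : x (Nat.find hex) 0 0 ≤ x (N + 2) 0 0 := h.strictMono.monotone (by omega)
    have h3 : (x (Nat.find hex) 0 0 : ℝ) ≤ x (N + 2) 0 0 := by exact_mod_cast h2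
    linarith
  obtain ⟨n, hn⟩ : ∃ n, Nat.find hex = n + 3 := Nat.exists_eq_add_of_le' (by omega)
  have hlt : (y 0 0 : ℝ) < x (n + 3) 0 0 := hn ▸ Nat.find_spec hex
  have hge : (x (n + 2) 0 0 : ℝ) ≤ y 0 0 := not_lt.mp (Nat.find_min hex (by omega))
  have ho := hN n (by omega)
  have hp := hN (n + 1) (by omega)
  have hq := hN (n + 2) (by omega)
  have hopq := h.mul_le_real n
  have hpqr := h.mul_le_real (n + 1)
  have hrpq := h.le_mul_real (n + 1)
  have hqrw := h.mul_le_real (n + 2)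
  have hwqr := h.le_mul_real (n + 2)
  simp only [add_assoc, Nat.reduceAdd] at hopq hpqr hrpq hqrw hwqr
  have p1 := h.pos (n + 1)
  have p2 := h.pos (n + 2)
  have p3 := h.pos (n + 3)
  have p4 := h.pos (n + 4)
  have hL2 : 0 < L ^ 2 := by positivity
  have hy0' : 0 < y 0 0 := by exact_mod_cast hy0
  have hx0' : ∀ i, 0 < x i 0 0 := fun i => by linarith [h.two_le i]
  have t1 := h.two_le_real (n + 2)
  have t2 := h.two_le_real (n + 3)
  -- With `p`, `q`, `r`, `w` consecutive upper left coefficients, one has `3 L p < q`.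
  have hpq : 3 * L * x (n + 1) 0 0 < x (n + 2) 0 0 := by nlinarith
  have hLp : L < x (n + 1) 0 0 := by linarith
  have hLq : L < x (n + 2) 0 0 := by linarith
  have hy1 : (1 : ℝ) ≤ y 0 0 := by linarith
  have hmid : det₃ (x (n + 2)) (x (n + 3)) y = 0 := by
    refine det₃_eq_zero hK (h.symm _) (h.symm _) hy p2 p3 hy0 (hxr _) (hxr _) hyr' ?_ ?_ ?_ <;>
      rw [← hL]
    · have e1 : L * x (n + 2) 0 0 < x (n + 3) 0 0 := by nlinarith
      exact e1.trans_le (le_mul_of_one_le_right p3.le hy1)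
    · have e1 : 3 * L * x (n + 1) 0 0 * x (n + 2) 0 0 < y 0 0 * x (n + 2) 0 0 :=
        mul_lt_mul_of_pos_right (hpq.trans_le hge) p2
      have e2 := mul_le_mul_of_nonneg_left hrpq hL0.le
      linarith
    · exact mul_lt_mul hLq hlt.le hy0 p2.le
  by_cases hcase : 4 * L * y 0 0 ≤ x (n + 3) 0 0
  · refine ⟨n + 2, eq_of_det₃_eq_zero (h.symm _) hy (h.det _) hyd (hx0' _) hy0'
      (h.det₃_ne_zero (n + 1)) ?_ hmid⟩
    refine det₃_eq_zero hK (h.symm _) (h.symm _) hy p1 p2 hy0 (hxr _) (hxr _) hyr' ?_ ?_ ?_ <;>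
      rw [← hL]
    · have e1 : 0 < L * x (n + 1) 0 0 := mul_pos hL0 p1
      have e2 := le_mul_of_one_le_right p2.le hy1
      linarith
    · exact mul_lt_mul hLp hge p2 p1.le
    · have e1 := mul_pos p1 p2
      linarith
  · push Not at hcase
    refine ⟨n + 3, eq_of_det₃_eq_zero (h.symm _) hy (h.det _) hyd (hx0' _) hy0'
      (h.det₃_ne_zero (n + 2)) hmid ?_⟩
    have hqa : 3 * L * x (n + 2) 0 0 < y 0 0 := by
      have e1 : x (n + 2) 0 0 * (12 * L ^ 2) ≤ x (n + 2) 0 0 * x (n + 1) 0 0 :=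
        mul_le_mul_of_nonneg_left (by linarith) p2.le
      have e2 : 4 * L * (3 * L * x (n + 2) 0 0) < 4 * L * y 0 0 := by linarith
      exact lt_of_mul_lt_mul_left e2 (by positivity)
    refine det₃_eq_zero hK (h.symm _) (h.symm _) hy p3 p4 hy0 (hxr _) (hxr _) hyr' ?_ ?_ ?_ <;>
      rw [← hL]
    · have e1 := mul_lt_mul_of_pos_left hLq p3
      have e2 := le_mul_of_one_le_right p4.le hy1
      linarith
    · have e1 := mul_lt_mul_of_pos_left hqa p3
      have e2 := mul_le_mul_of_nonneg_left hwqr hL0.le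
      linarith
    · have e1 := le_mul_of_one_le_left p2.le (by linarith : (1 : ℝ) ≤ x (n + 3) 0 0)
      have e2 : L < x (n + 4) 0 0 := by linarith
      have e3 := mul_lt_mul hlt e2.le hL0 p3.le
      linarith

end IsReduced

lemma IsGrowing.eventually_mul_lt {e : ℤ} {x : ℕ → Mat} (h : IsGrowing e x) (Q : ℝ) :
    ∀ᶠ i in atTop, Q * x i 0 0 < x (i + 1) 0 0 := by
  obtain ⟨N, hN⟩ := eventually_atTop.mp (h.tendsto_atTop.eventually_gt_atTop Q)
  refine eventually_atTop.mpr ⟨N + 1, fun i hi => ?_⟩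
  obtain ⟨k, rfl⟩ : ∃ k, i = k + 1 := ⟨i - 1, by omega⟩
  have h1 := hN k (by omega)
  have h2 := h.mul_le_real k
  have h3 := h.pos (k + 1)
  nlinarith

/-- If the upper left coefficients of a growing chain are comparable to those of the elements of
indices `φ 0, φ 1, …` of another one, then `φ` eventually has no gaps: since each coefficient is
comparable to the product of the previous two, a gap would make the coefficients grow too fast. -/
lemma eventually_succ {e e' : ℤ} {x x' : ℕ → Mat} (h : IsGrowing e x) (h' : IsGrowing e' x')
    {c₁ c₂ : ℝ} (hc₁ : 0 < c₁) (hc₂ : 0 < c₂) {φ : ℕ → ℕ}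
    (hφ : ∀ᶠ j in atTop, c₁ * x' j 0 0 ≤ x (φ j) 0 0 ∧ (x (φ j) 0 0 : ℝ) ≤ c₂ * x' j 0 0) :
    ∀ᶠ j in atTop, φ (j + 1) = φ j + 1 := by
  have hlt : ∀ᶠ j in atTop, φ j < φ (j + 1) := by
    filter_upwards [hφ, (tendsto_add_atTop_nat 1).eventually hφ,
      h'.eventually_mul_lt (c₂ / c₁)] with j h1 h2 h3
    rw [← h.strictMono.lt_iff_lt]
    have h4 : c₂ * x' j 0 0 < c₁ * x' (j + 1) 0 0 := by
      rw [div_mul_eq_mul_div, div_lt_iff₀ hc₁] at h3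
      linarith
    have h5 : (x (φ j) 0 0 : ℝ) < x (φ (j + 1)) 0 0 := by linarith [h1.2, h2.1]
    exact_mod_cast h5
  obtain ⟨I, hI⟩ := eventually_atTop.mp (h.eventually_mul_lt (3 * c₂ / c₁ ^ 2))
  have hφI : ∀ᶠ j in atTop, I ≤ φ j := by
    filter_upwards [hφ, h'.tendsto_atTop.eventually_ge_atTop (x I 0 0 / c₁)] with j h1 h2
    rw [← h.strictMono.le_iff_le]
    rw [div_le_iff₀ hc₁] at h2
    have h3 : (x I 0 0 : ℝ) ≤ x (φ j) 0 0 := by linarith [h1.1]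
    exact_mod_cast h3
  filter_upwards [hφ, (tendsto_add_atTop_nat 1).eventually hφ, (tendsto_add_atTop_nat 2).eventually hφ,
    hlt, (tendsto_add_atTop_nat 1).eventually hlt, hφI] with j h1 h2 h3 h4 h5 h6
  by_contra hne
  obtain ⟨i, hi⟩ : ∃ i, φ (j + 1) = i + 1 := ⟨φ (j + 1) - 1, by omega⟩
  rw [show j + 1 + 1 = j + 2 by rfl] at h5
  have e1 : (x (i + 1) 0 0 : ℝ) * x i 0 0 ≤ x (φ (j + 2)) 0 0 := by
    refine (h.mul_le_real i).trans ?_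
    exact_mod_cast h.strictMono.monotone (show i + 2 ≤ φ (j + 2) by omega)
  have e2 : (x (φ j + 1) 0 0 : ℝ) ≤ x i 0 0 := by
    exact_mod_cast h.strictMono.monotone (show φ j + 1 ≤ i by omega)
  have e3 := hI (φ j) h6
  rw [div_mul_eq_mul_div, div_lt_iff₀ (by positivity)] at e3
  have e4 := h'.le_mul_real j
  rw [hi] at h2
  have p0 := h'.pos j
  have p1 := h'.pos (j + 1)
  have q0 := h.pos (φ j)
  have q1 := h.pos (i + 1)
  have e5 : (x (i + 1) 0 0 : ℝ) * x (φ j + 1) 0 0 ≤ 3 * c₂ * (x' (j + 1) 0 0 * x' j 0 0) := by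
    have : (x (i + 1) 0 0 : ℝ) * x (φ j + 1) 0 0 ≤ x (i + 1) 0 0 * x i 0 0 := by gcongr
    have h7 : c₂ * x' (j + 2) 0 0 ≤ c₂ * (3 * (x' (j + 1) 0 0 * x' j 0 0)) := by gcongr
    linarith [h3.2]
  have e6 : c₁ ^ 2 * (x' (j + 1) 0 0 * x' j 0 0 : ℝ) ≤ x (i + 1) 0 0 * x (φ j) 0 0 := by
    calc c₁ ^ 2 * (x' (j + 1) 0 0 * x' j 0 0 : ℝ) =
        (c₁ * x' (j + 1) 0 0) * (c₁ * x' j 0 0) := by ring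
      _ ≤ _ := by
        refine mul_le_mul h2.1 h1.1 ?_ q1.le
        positivity
  have e7 : (x (i + 1) 0 0 : ℝ) * (3 * c₂ * x (φ j) 0 0) <
      x (i + 1) 0 0 * (x (φ j + 1) 0 0 * c₁ ^ 2) := by gcongr
  have e8 : (x (i + 1) 0 0 : ℝ) * x (φ j + 1) 0 0 * c₁ ^ 2 ≤
      3 * c₂ * (x' (j + 1) 0 0 * x' j 0 0) * c₁ ^ 2 := by gcongr
  nlinarith

/-- If the limits of two reduced chains are related by a linear fractional transformation of
determinant `± 1`, then this transformation maps all but finitely many elements of one chain to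
elements of the other one, with a shift of indices, and the comparison of the recurrence relations
shows that it preserves the upper left coefficients. -/
lemma exists_shift {e e' : ℤ} {x x' : ℕ → Mat} (h : IsReduced e x) (h' : IsReduced e' x') {ξ ξ' : ℝ}
    (hξ : Tendsto (fun i => ratio (x i)) atTop (𝓝 ξ))
    (hξ' : Tendsto (fun i => ratio (x' i)) atTop (𝓝 ξ')) {a b c d : ℤ}
    (hdet : (a * d - b * c) ^ 2 = 1) (hξξ' : ξ' * (c * ξ + d) = a * ξ + b) :
    ∃ I J : ℕ, ∀ i, x (i + I) 0 0 = x' (i + J) 0 0 := by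
  set G : Mat := !![a, -b; -c, d] with hG
  have hGdet : G.det ^ 2 = 1 := by
    rw [hG, Matrix.det_fin_two_of, ← hdet]; ring
  set y : ℕ → Mat := fun j => G.transpose * x' j * G with hy
  have hysymm : ∀ j, (y j).IsSymm := by
    intro j
    simp only [hy, Matrix.IsSymm, Matrix.transpose_mul, Matrix.transpose_transpose,
      (h'.symm j).eq, Matrix.mul_assoc]
  have hydet : ∀ j, (y j).det = 1 := by
    intro j
    simp only [hy, Matrix.det_mul, Matrix.det_transpose, h'.det j]
    linear_combination hGdet
  have hentry : ∀ j, y j 0 0 = a ^ 2 * x' j 0 0 - 2 * a * c * x' j 0 1 + c ^ 2 * x' j 1 1 ∧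
      y j 0 1 = -a * b * x' j 0 0 + (a * d + b * c) * x' j 0 1 - c * d * x' j 1 1 ∧
      y j 1 1 = b ^ 2 * x' j 0 0 - 2 * b * d * x' j 0 1 + d ^ 2 * x' j 1 1 := by
    intro j
    simp only [hy, hG, Matrix.mul_apply, Fin.sum_univ_two, Matrix.transpose_apply,
      symm_apply (h'.symm j)]
    simp
    refine ⟨?_, ?_, ?_⟩ <;> ring
  obtain ⟨C, hC, hr⟩ := h'.rowNorm_le hξ'
  -- The factors `cξ + d` and `a - cξ'` are inverse to each other up to sign.
  set κ : ℝ := (a - c * ξ') ^ 2 with hκ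
  have hκ0 : 0 < κ := by
    refine sq_pos_of_ne_zero (fun h0 => ?_)
    have h1 : ((a * d - b * c : ℤ) : ℝ) = (c * ξ + d) * (a - c * ξ') := by
      push_cast; linear_combination (c : ℝ) * hξξ'
    rw [h0, mul_zero, Int.cast_eq_zero] at h1
    rw [h1] at hdet
    norm_num at hdet
  set S : ℝ := |(a : ℝ)| + |(b : ℝ)| + |(c : ℝ)| + |(d : ℝ)| with hS
  have hrow : ∀ j, |ξ' * x' j 0 0 - x' j 0 1| ≤ C / x' j 0 0 ∧
      |ξ' * x' j 0 1 - x' j 1 1| ≤ C / x' j 0 0 := by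
    intro j
    have h1 := hr j
    rw [rowNorm_apply (h'.symm j)] at h1
    exact ⟨(le_max_left _ _).trans h1, (le_max_right _ _).trans h1⟩
  have hsize : ∀ᶠ j in atTop, κ / 2 * x' j 0 0 ≤ y j 0 0 ∧ (y j 0 0 : ℝ) ≤ 2 * κ * x' j 0 0 := by
    set T : ℝ := (|2 * a * c - c ^ 2 * ξ'| + |(c : ℝ) ^ 2|) * C with hT
    filter_upwards [h'.tendsto_atTop.eventually_ge_atTop (2 * T / κ)] with j hj
    obtain ⟨h1, h2⟩ := hrow j
    have hm := h'.two_le_real j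
    have hCm : C / x' j 0 0 ≤ C := div_le_self hC.le (by linarith)
    have e1 : (y j 0 0 : ℝ) - κ * x' j 0 0 =
        (2 * a * c - c ^ 2 * ξ') * (ξ' * x' j 0 0 - x' j 0 1) -
          c ^ 2 * (ξ' * x' j 0 1 - x' j 1 1) := by
      rw [(hentry j).1, hκ]; push_cast; ring
    have e2 : |(y j 0 0 : ℝ) - κ * x' j 0 0| ≤ T := by
      rw [e1, hT, add_mul]
      refine (abs_sub _ _).trans ?_
      rw [abs_mul, abs_mul]
      have := h1.trans hCm
      have := h2.trans hCm
      gcongr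
    rw [div_le_iff₀ hκ0] at hj
    rw [abs_le] at e2
    constructor <;> nlinarith [e2.1, e2.2]
  have hyrow : ∀ᶠ j in atTop, rowNorm ξ (y j) ≤ |c * ξ + d| * S * C * (2 * κ) / y j 0 0 := by
    filter_upwards [hsize] with j hj
    obtain ⟨h1, h2⟩ := hrow j
    have hm := h'.pos j
    have hy0 : (0 : ℝ) < y j 0 0 := lt_of_lt_of_le (by positivity) hj.1
    have hCm : C / x' j 0 0 ≤ C * (2 * κ) / y j 0 0 := by
      rw [div_le_div_iff₀ hm hy0]
      nlinarith [mul_le_mul_of_nonneg_left hj.2 hC.le]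
    have hD : 0 ≤ C / x' j 0 0 := by positivity
    have comb : ∀ p q : ℤ, |(p : ℝ)| + |(q : ℝ)| ≤ S →
        |(c * ξ + d) * (p * (ξ' * x' j 0 0 - x' j 0 1) + q * (ξ' * x' j 0 1 - x' j 1 1))| ≤
          |c * ξ + d| * S * C * (2 * κ) / y j 0 0 := by
      intro p q hpq
      rw [abs_mul]
      calc |c * ξ + d| * |p * (ξ' * x' j 0 0 - x' j 0 1) + q * (ξ' * x' j 0 1 - x' j 1 1)|
          ≤ |c * ξ + d| * (|(p : ℝ)| * (C / x' j 0 0) + |(q : ℝ)| * (C / x' j 0 0)) := by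
            gcongr
            refine (abs_add_le _ _).trans ?_
            rw [abs_mul, abs_mul]
            gcongr
        _ = |c * ξ + d| * ((|(p : ℝ)| + |(q : ℝ)|) * (C / x' j 0 0)) := by ring
        _ ≤ |c * ξ + d| * (S * (C * (2 * κ) / y j 0 0)) := by gcongr
        _ = _ := by ring
    rw [rowNorm_apply (hysymm j)]
    have ha := abs_nonneg (a : ℝ)
    have hb := abs_nonneg (b : ℝ)
    have hc := abs_nonneg (c : ℝ)
    have hd := abs_nonneg (d : ℝ)
    refine max_le ?_ ?_
    · have e1 : ξ * y j 0 0 - y j 0 1 = (c * ξ + d) * ((a : ℤ) * (ξ' * x' j 0 0 - x' j 0 1) +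
          ((-c : ℤ) : ℝ) * (ξ' * x' j 0 1 - x' j 1 1)) := by
        rw [(hentry j).1, (hentry j).2.1]; push_cast
        linear_combination (-(a * x' j 0 0 - c * x' j 0 1) : ℝ) * hξξ'
      rw [e1]
      refine comb _ _ ?_
      rw [Int.cast_neg, abs_neg]; linarith
    · have e1 : ξ * y j 0 1 - y j 1 1 = (c * ξ + d) * (((-b : ℤ) : ℝ) * (ξ' * x' j 0 0 - x' j 0 1) +
          (d : ℤ) * (ξ' * x' j 0 1 - x' j 1 1)) := by
        rw [(hentry j).2.1, (hentry j).2.2]; push_cast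
        linear_combination (b * x' j 0 0 - d * x' j 0 1 : ℝ) * hξξ'
      rw [e1]
      refine comb _ _ ?_
      rw [Int.cast_neg, abs_neg]; linarith
  obtain ⟨A, hA⟩ := h.exists_eq hξ (|c * ξ + d| * S * C * (2 * κ))
  have hmem : ∀ᶠ j in atTop, ∃ i, y j = x i := by
    filter_upwards [hsize, hyrow, h'.tendsto_atTop.eventually_ge_atTop (A / (κ / 2))] with j h1 h2 h3
    refine hA _ (hysymm j) (hydet j) ?_ h2
    rw [div_le_iff₀ (by positivity)] at h3
    linarith [h1.1]
  obtain ⟨φ, hφ⟩ : ∃ φ : ℕ → ℕ, ∀ᶠ j in atTop, y j = x (φ j) := by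
    classical
    refine ⟨fun j => if hj : ∃ i, y j = x i then hj.choose else 0, ?_⟩
    filter_upwards [hmem] with j hj
    rw [dif_pos hj]
    exact hj.choose_spec
  have hsucc : ∀ᶠ j in atTop, φ (j + 1) = φ j + 1 := by
    refine eventually_succ h.toIsGrowing h'.toIsGrowing (c₁ := κ / 2) (c₂ := 2 * κ)
      (by positivity) (by positivity) ?_
    filter_upwards [hsize, hφ] with j h1 h2
    rwa [← h2]
  obtain ⟨J, hJ⟩ := eventually_atTop.mp (hφ.and hsucc)
  have hφJ : ∀ i, φ (i + J) = i + φ J := by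
    intro i
    induction i with
    | zero => simp
    | succ i ih =>
      rw [add_right_comm, (hJ (i + J) (by omega)).2, ih]; omega
  have hyx : ∀ i, y (i + J) = x (i + φ J) := fun i => by
    rw [(hJ (i + J) (by omega)).1, hφJ]
  have hc0 : c = 0 := by
    have e0 := hyx 0
    have e1 := hyx 1
    have e2 := hyx 2
    rw [zero_add, zero_add] at e0
    rw [add_comm 1, add_comm 1] at e1
    rw [add_comm 2, add_comm 2, h.succ, ← e1, ← e0] at e2
    simp only [hy] at e2
    rw [h'.succ] at e2
    generalize e * (-1) ^ φ J = ε at e2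
    generalize e' * (-1) ^ J = ε' at e2
    have u0 : IsUnit (x' J) := by rw [Matrix.isUnit_iff_isUnit_det, h'.det]; exact isUnit_one
    have u1 : IsUnit (x' (J + 1)) := by rw [Matrix.isUnit_iff_isUnit_det, h'.det]; exact isUnit_one
    have uG : IsUnit G := by
      rw [Matrix.isUnit_iff_isUnit_det]
      exact IsUnit.of_mul_eq_one G.det (by rw [← sq]; exact hGdet)
    have uG' : IsUnit G.transpose := by
      rw [Matrix.isUnit_iff_isUnit_det, Matrix.det_transpose, ← Matrix.isUnit_iff_isUnit_det]
      exact uG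
    have e3 : (G.transpose * x' (J + 1)) * (matN ε') * (x' J * G) =
        (G.transpose * x' (J + 1)) * (G * matN ε * G.transpose) * (x' J * G) := by
      simpa only [Matrix.mul_assoc] using e2
    have e4 := (uG'.mul u1).mul_left_cancel ((u0.mul uG).mul_right_cancel e3)
    have e5 := congrFun (congrFun e4 1) 1
    simp [matN, hG, Matrix.mul_apply, Fin.sum_univ_two] at e5
    have e6 : c * c = 0 := by linarith
    exact mul_self_eq_zero.mp e6
  refine ⟨φ J, J, fun i => ?_⟩
  rw [← hyx, (hentry _).1, hc0]
  rw [hc0] at hdet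
  have ha : a ^ 2 = 1 := by
    have : IsUnit (a ^ 2) := IsUnit.of_mul_eq_one (d ^ 2) (by linear_combination hdet)
    rcases Int.isUnit_iff.mp this with h1 | h1
    · exact h1
    · nlinarith [sq_nonneg a]
  linear_combination x' (i + J) 0 0 * ha

/-! ### The numbers attached to the nodes -/

/-- As `√(9m² - 4)` differs from `3m` by at most `2`, both `α_m` and the sum of `3` and of the
conjugate of `α_m` differ from `k/m` by at most `1/m`. -/
lemma alpha_sub_le {m : Triple} (hm : m ∈ SigmaStar) :
    |alpha m - ratio (xMat m)| ≤ 1 / m.1 ∧ |alphaBar m + 3 - ratio (xMat m)| ≤ 1 / m.1 := by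
  have hspec := spec_of_mem hm
  have hm1 : (1 : ℝ) ≤ m.1 := by exact_mod_cast (by omega : 1 ≤ m.1)
  rw [alpha, alphaBar, ratio, (xMat_spec hm).fst]
  generalize (m.1 : ℝ) = a at *
  generalize (xMat m 0 1 : ℝ) = k at *
  have ha : 0 < a := by linarith
  have h1 : √(9 * a ^ 2 - 4) ≤ 3 * a := Real.sqrt_le_iff.mpr ⟨by linarith, by nlinarith⟩
  have h2 : 3 * a - 2 ≤ √(9 * a ^ 2 - 4) := Real.le_sqrt_of_sq_le (by nlinarith)
  have e1 : (2 * k - 3 * a + √(9 * a ^ 2 - 4)) / (2 * a) - k / a =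
      (√(9 * a ^ 2 - 4) - 3 * a) / 2 / a := by field_simp; ring
  have e2 : (2 * k - 3 * a - √(9 * a ^ 2 - 4)) / (2 * a) + 3 - k / a =
      (3 * a - √(9 * a ^ 2 - 4)) / 2 / a := by field_simp; ring
  have hdiv : ∀ u : ℝ, |u / a| = |u| / a := fun u => by rw [abs_div, abs_of_pos ha]
  rw [e1, e2, hdiv, hdiv]
  constructor <;> refine div_le_div_of_nonneg_right ?_ ha.le <;> rw [abs_le] <;>
    constructor <;> linarith

/-- The properties of the limit of the quotients `k/m` along a zigzag. -/
lemma limit_spec {z : ℕ → Triple} (hz : IsZigzag z) {ξ : ℝ}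
    (hξ : Tendsto (fun i => ratio (xMat (z i))) atTop (𝓝 ξ)) :
    (∀ i, (xMat (z i)).IsSymm ∧ (xMat (z i)).det = 1) ∧ IsExtremal ξ ∧
      IsMatrixSequence ξ (fun i => xMat (z i)) ∧ ξ ∈ EPlus 3 ∩ Set.Ioo (1 / 2 : ℝ) 1 ∧
      Tendsto (fun i => alpha (z i)) atTop (𝓝 ξ) ∧
      Tendsto (fun i => alphaBar (z i) + 3) atTop (𝓝 ξ) := by
  obtain ⟨e, h⟩ := hz.isReduced
  have hx := fun i => xMat_spec (hz.mem i)
  have hext := h.isExtremal hξ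
  have hseq := h.isMatrixSequence hξ
  have hdiv : Tendsto (fun i => 1 / ((z i).1 : ℝ)) atTop (𝓝 0) := by
    refine (h.tendsto_const_div 1).congr (fun i => ?_)
    rw [(hx i).fst]
  have hlim : ∀ f : ℕ → ℝ, (∀ i, |f i - ratio (xMat (z i))| ≤ 1 / (z i).1) →
      Tendsto f atTop (𝓝 ξ) := by
    intro f hf
    have h1 : Tendsto (fun i => f i - ratio (xMat (z i))) atTop (𝓝 0) :=
      squeeze_zero_norm hf hdiv
    simpa using h1.add hξ
  refine ⟨fun i => ⟨(hx i).symm, (hx i).det⟩, hext, hseq, ⟨⟨hext, ?_⟩, ?_⟩,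
    hlim _ fun i => (alpha_sub_le (hz.mem i)).1, hlim _ fun i => (alpha_sub_le (hz.mem i)).2⟩
  · -- The sign with which the recurrence starts is `1` either for the chain or for its tail.
    have hshift : ∃ n, e * (-1) ^ n = 1 := by
      rcases sq_eq_sq_iff_eq_or_eq_neg.mp (h.sq.trans (one_pow 2).symm) with he | he
      · exact ⟨0, by rw [he]; norm_num⟩
      · exact ⟨1, by rw [he]; norm_num⟩
    obtain ⟨n, hn⟩ := hshift
    have ht : IsReduced (e * (-1) ^ n) (fun i => xMat (z (i + n))) :=
      ⟨h.toIsGrowing.tail n, fun i => h.snd_nonneg _, fun i => h.snd_le _⟩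
    rw [hn] at ht
    refine ⟨_, ht.isMatrixSequence ((tendsto_add_atTop_iff_nat n).mpr hξ), ht.det, fun j => ?_⟩
    rw [matE_eq]
    exact ht.succ j
  · -- The limit belongs to `[1/2, 1]` and is not an end point since it is irrational.
    have hpos : ∀ i, (0 : ℝ) < (z i).1 := fun i => by exact_mod_cast (hx i).pos
    have h1 : ξ ≤ 1 := le_of_tendsto' hξ fun i => by
      rw [ratio, (hx i).fst, div_le_one (hpos i)]
      exact_mod_cast (hx i).snd_le
    have h2 : 1 / 2 ≤ ξ := ge_of_tendsto' hξ fun i => by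
      rw [ratio, (hx i).fst, div_le_div_iff₀ two_pos (hpos i)]
      have : ((z i).1 : ℝ) ≤ 2 * xMat (z i) 0 1 := by exact_mod_cast (hx i).le_snd
      linarith
    refine ⟨lt_of_le_of_ne h2 fun h0 => ?_, lt_of_le_of_ne h1 fun h0 => ?_⟩
    · have := hext.1 0 2 (-1) (by rw [← h0]; norm_num)
      omega
    · have := hext.1 0 1 (-1) (by rw [h0]; norm_num)
      omega

lemma IsExtremal.linear_ne_zero {ξ : ℝ} (h : IsExtremal ξ) {c d : ℤ} (hcd : ¬ (c = 0 ∧ d = 0)) :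
    c * ξ + d ≠ 0 := fun h0 => hcd (h.1 0 c d (by push_cast; linarith)).2

/-- Limits along maximal zigzags which are equivalent to the same number belong to the same node. -/
lemma zero_eq_of_equivalent {w w' : ℕ → Triple} (hw : IsMaximalZigzag w) (hw' : IsMaximalZigzag w')
    {ξ ξ' η : ℝ} (hξ : Tendsto (fun i => ratio (xMat (w i))) atTop (𝓝 ξ))
    (hξ' : Tendsto (fun i => ratio (xMat (w' i))) atTop (𝓝 ξ'))
    (h : Equivalent η ξ) (h' : Equivalent η ξ') : w 0 = w' 0 := by
  have hext := (limit_spec hw.1 hξ).2.1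
  have hext' := (limit_spec hw'.1 hξ').2.1
  obtain ⟨g, hg⟩ := h
  obtain ⟨g', hg'⟩ := h'
  have hdet : ∀ g : GL (Fin 2) ℤ, (g.1 0 0 * g.1 1 1 - g.1 0 1 * g.1 1 0) ^ 2 = 1 := by
    intro g
    rw [← Matrix.det_fin_two]
    rcases Int.isUnit_iff.mp ((Matrix.isUnit_iff_isUnit_det _).mp g.isUnit) with h1 | h1 <;>
      rw [h1] <;> norm_num
  have hd := hdet g
  have hd' := hdet g'
  generalize g.1 0 0 = a at *
  generalize g.1 0 1 = b at *
  generalize g.1 1 0 = c at *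
  generalize g.1 1 1 = d at *
  generalize g'.1 0 0 = a' at *
  generalize g'.1 0 1 = b' at *
  generalize g'.1 1 0 = c' at *
  generalize g'.1 1 1 = d' at *
  have hne : c * ξ + d ≠ 0 := hext.linear_ne_zero (by rintro ⟨rfl, rfl⟩; norm_num at hd)
  have hne' : c' * ξ' + d' ≠ 0 := hext'.linear_ne_zero (by rintro ⟨rfl, rfl⟩; norm_num at hd')
  rw [hg, div_eq_div_iff hne hne'] at hg'
  obtain ⟨e, hr⟩ := hw.1.isReduced
  obtain ⟨e', hr'⟩ := hw'.1.isReduced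
  -- The composition of the first transformation and of the inverse of the second one.
  obtain ⟨I, J, hIJ⟩ := exists_shift hr hr' hξ hξ' (a := d' * a - b' * c) (b := d' * b - b' * d)
    (c := a' * c - c' * a) (d := a' * d - c' * b)
    (by linear_combination (a * d - b * c) ^ 2 * hd' + hd)
    (by push_cast; linear_combination -hg')
  refine maximal_eq_of_tail hw hw' (I + 2) (J + 2) (zigzag_eq_of_fst hw.1 hw'.1 fun i => ?_)
  have := hIJ i
  rwa [(xMat_spec (hw.1.mem _)).fst, (xMat_spec (hw'.1.mem _)).fst] at this

/-- Each element of `E₃⁺` is equivalent to the limit along some maximal zigzag. -/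
lemma exists_equivalent {η : ℝ} (hη : η ∈ EPlus 3) :
    ∃ w, IsMaximalZigzag w ∧
      ∀ ξ, Tendsto (fun i => ratio (xMat (w i))) atTop (𝓝 ξ) → Equivalent η ξ := by
  obtain ⟨z, e, x, hz, hx, hxz, hlim⟩ := exists_zigzag_of_mem_EPlus hη
  obtain ⟨w, N, hw, hwz⟩ := hz.exists_maximal (z 0).1.toNat z
    (by have := spec_of_mem (hz.mem 0); omega)
  refine ⟨w, hw, fun ξ hξ => ?_⟩
  obtain ⟨e', h⟩ := hw.1.isReduced
  have hc : IsCoprime (x 1 0 0) (x 2 0 0) := by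
    rw [hxz, hxz]
    obtain ⟨s, -, h1⟩ := hz 0
    obtain ⟨p, hp⟩ := mem_range_of_ne_root h1.2.1 (by rw [h1.2.2]; exact step_ne_root h1.1 _)
    have hcop := tripleAt_coprime p
    rw [hp] at hcop
    rcases zigzag_snd hz 0 with h2 | h2 <;> rw [zero_add, zero_add] at h2 <;>
      rw [zero_add] at hcop <;> rw [h2] at hcop
    · exact hcop.1.symm
    · exact hcop.2.1.symm
  obtain ⟨s, t, hs, hst⟩ := limit_eq_of_fst_eq hx (h.toIsGrowing.tail N)
    (fun i => by rw [hxz, (xMat_spec (hw.1.mem _)).fst, hwz]) hc hlim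
    ((tendsto_add_atTop_iff_nat N).mpr hξ)
  have hdet : (!![s, t; 0, 1] : Mat).det = s := by simp [Matrix.det_fin_two]
  have hu : IsUnit (!![s, t; 0, 1] : Mat) := by
    rw [Matrix.isUnit_iff_isUnit_det, hdet]
    exact IsUnit.of_mul_eq_one s (by rw [← sq]; exact hs)
  refine ⟨hu.unit, ?_⟩
  rw [hst]
  simp

end MarkoffExtremal

open MarkoffExtremal in
theorem theorem3p5 :
    (∀ m : SigmaStar, ∃! z : ℕ → Triple, IsMaximalZigzag z ∧ z 0 = m) ∧
    ∃ ξ : SigmaStar → ℝ,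
      (∀ (m : SigmaStar) (z : ℕ → Triple), IsMaximalZigzag z → z 0 = m →
        (∀ i, (xMat (z i)).IsSymm ∧ (xMat (z i)).det = 1) ∧
        IsExtremal (ξ m) ∧
        IsMatrixSequence (ξ m) (fun i => xMat (z i)) ∧
        ξ m ∈ EPlus 3 ∩ Set.Ioo (1 / 2 : ℝ) 1 ∧
        Tendsto (fun i => alpha (z i)) atTop (𝓝 (ξ m)) ∧
        Tendsto (fun i => alphaBar (z i) + 3) atTop (𝓝 (ξ m))) ∧
      ∀ η ∈ EPlus 3, ∃! m : SigmaStar, Equivalent η (ξ m) := by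
  have huniq := fun m : SigmaStar => existsUnique_maximalZigzag m m.2
  choose Z hZ using fun m => (huniq m).exists
  choose ξ hξ using fun m => (hZ m).1.1.isReduced.choose_spec.exists_limit
  refine ⟨huniq, ξ, fun m z hz hz0 => ?_, fun η hη => ?_⟩
  · obtain rfl : z = Z m := (huniq m).unique ⟨hz, hz0⟩ (hZ m)
    exact limit_spec hz.1 (hξ m)
  · obtain ⟨w, hw, hwη⟩ := exists_equivalent hη
    set n : SigmaStar := ⟨w 0, hw.1.mem 0⟩ with hn
    have hwn : w = Z n := (huniq n).unique ⟨hw, rfl⟩ (hZ n)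
    have hηn : Equivalent η (ξ n) := hwη _ (by rw [hwn]; exact hξ n)
    refine ⟨n, hηn, fun m hm => Subtype.ext ?_⟩
    rw [← (hZ m).2, ← (hZ n).2]
    exact zero_eq_of_equivalent (hZ m).1 (hZ n).1 (hξ m) (hξ n) hm hηn
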